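/- Let $G$ be a unimodular locally compact (Hausdorff) group, $U\subseteq G$ a compact open subgroup, and $\mu$ the Haar measure on $G$ with $\mu(U)=1$. Let $\mathcal H(G,U)$ be the $*$-algebra of compactly supported $U$-biinvariant functions $f:G\to\mathbb C$ with convolution $(f_1*f_2)(g)=\int_G f_1(h)f_2(h^{-1}g)\,d\mu(h)$ and involution $f^*(g)=\overline{f(g^{-1})}$, and let $L^1(G,U)$ be its completion in the $L^1$-norm, a Banach $*$-algebra. Assume that $(G,U)$ is a Gelfand pair, i.e. that $L^1(G,U)$ is commutative. A spherical function is a continuous function $\omega:G\to\mathbb C$ with $\omega(e)=1$, $\omega(u_1gu_2)=\omega(g)$ for all $g\in G$ and $u_1,u_2\in U$, and $\int_U\omega(g_1ug_2)\,d\mu(u)=\omega(g_1)\omega(g_2)$ for all $g_1,g_2\in G$; it is $*$-spherical if moreover $\omega(g^{-1})=\overline{\omega(g)}$ for all $g\in G$. It is positive definite if $\sum_{j,k=1}^m\omega(s_j^{-1}s_k)\overline{z_j}z_k\ge 0$ for all $m\geq 1$, $s_1,\dots,s_m\in G$ and $z_1,\dots,z_m\in\mathbb C$. For a $*$-algebra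 $A$, the universal $C^*$-completion of $A$ exists if $\sup_\pi\|\pi(a)\|<\infty$ for every $a\in A$, the supremum being over all $*$-representations of $A$ by bounded operators on Hilbert spaces; it is then the (Hausdorff) completion of $A$ in this $C^*$-seminorm. For Banach $*$-algebras with isometric involution it always exists. Write $C^*(G,U)$ for the universal $C^*$-completion of $\mathcal H(G,U)$ (if it exists), $C^*(L^1(G,U))$ for that of $L^1(G,U)$, $C^*(G)$ for that of $L^1(G)$, and let $p_0\in C^*(G)$ be the projection given by the indicator function $\chi_U$. Then the following are equivalent: (a) All $*$-spherical functions are bounded and positive definite. (b) The universal $C^*$-completion $C^*(G,U)$ exists and both natural maps $$C^*(G,U)\longrightarrow C^*(L^1(G,U))\longrightarrow p_0C^*(G)p_0,$$ induced by the inclusions $\mathcal H(G,U)\subseteq L^1(G,U)\subseteq L^1(G)$, are isomorphisms. -/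

import Mathlib

open MeasureTheory UniformSpace
open scoped ENNReal ComplexOrder CompactlySupported

set_option linter.unusedSectionVars false

noncomputable section

universe u

/-! ### Completion of a normed star-algebra without unit -/

namespace UniformSpace.Completion

section NonUnital

variable {A : Type u} [NonUnitalSeminormedRing A]

instance nonUnitalMul : Mul (Completion A) :=
  ⟨Function.curry <| (isDenseInducing_coe.prodMap isDenseInducing_coe).extend
    ((↑) ∘ Function.uncurry (· * ·))⟩

theorem nonUnital_coe_mul (a b : A) : ((a * b : A) : Completion A) = a * b :=
  ((isDenseInducing_coe.prodMap isDenseInducing_coe).extend_eq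
    ((continuous_coe A).comp (@continuous_mul A _ _ _)) (a, b)).symm

instance nonUnitalContinuousMul : ContinuousMul (Completion A) where
  continuous_mul := by
    let m := (AddMonoidHom.mul : A →+ A →+ A).compr₂ toCompl
    have : Continuous fun p : A × A => m p.1 p.2 := (continuous_coe A).comp continuous_mul
    have di : IsDenseInducing (toCompl : A → Completion A) := isDenseInducing_coe
    exact (di.extend_Z_bilin di this :)

section

variable [NormedSpace ℂ A]

theorem continuous_nonUnital_smul (c : ℂ) : Continuous fun x : Completion A => c • x :=
  UniformContinuousConstSMul.uniformContinuous_const_smul c |>.continuous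

instance nonUnitalIsScalarTower [IsScalarTower ℂ A A] :
    IsScalarTower ℂ (Completion A) (Completion A) where
  smul_assoc c a b := by
    change (c • a) * b = c • (a * b)
    induction a, b using Completion.induction_on₂ with
    | hp => exact isClosed_eq
              (((continuous_nonUnital_smul c).comp continuous_fst).mul continuous_snd)
              ((continuous_nonUnital_smul c).comp continuous_mul)
    | ih a b => simp only [← coe_smul, ← nonUnital_coe_mul, smul_mul_assoc]

instance nonUnitalSMulCommClass [SMulCommClass ℂ A A] :
    SMulCommClass ℂ (Completion A) (Completion A) where
  smul_comm c a b := by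
    change c • (a * b) = a * (c • b)
    induction a, b using Completion.induction_on₂ with
    | hp => exact isClosed_eq ((continuous_nonUnital_smul c).comp continuous_mul)
              (continuous_fst.mul ((continuous_nonUnital_smul c).comp continuous_snd))
    | ih a b => simp only [← coe_smul, ← nonUnital_coe_mul, mul_smul_comm]

end

instance nonUnitalNormedRing : NonUnitalNormedRing (Completion A) where
  __ : NormedAddCommGroup (Completion A) := inferInstance
  __ : Mul (Completion A) := nonUnitalMul
  zero_mul a := by
    induction a using Completion.induction_on with
    | hp => exact isClosed_eq (by fun_prop) continuous_const
    | ih a => rw [← coe_zero, ← nonUnital_coe_mul, zero_mul]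
  mul_zero a := by
    induction a using Completion.induction_on with
    | hp => exact isClosed_eq (by fun_prop) continuous_const
    | ih a => rw [← coe_zero, ← nonUnital_coe_mul, mul_zero]
  mul_assoc a b c := by
    induction a, b, c using Completion.induction_on₃ with
    | hp => exact isClosed_eq (by fun_prop) (by fun_prop)
    | ih a b c => simp only [← nonUnital_coe_mul, mul_assoc]
  left_distrib a b c := by
    induction a, b, c using Completion.induction_on₃ with
    | hp => exact isClosed_eq (by fun_prop) (by fun_prop)
    | ih a b c => simp only [← nonUnital_coe_mul, ← coe_add, mul_add]
  right_distrib a b c := by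
    induction a, b, c using Completion.induction_on₃ with
    | hp => exact isClosed_eq (by fun_prop) (by fun_prop)
    | ih a b c => simp only [← nonUnital_coe_mul, ← coe_add, add_mul]
  norm_mul_le a b := by
    induction a, b using Completion.induction_on₂ with
    | hp => exact isClosed_le (by fun_prop) (by fun_prop)
    | ih a b => simpa only [← nonUnital_coe_mul, norm_coe] using norm_mul_le a b

variable [StarRing A]

instance instStar : Star (Completion A) := ⟨Completion.map star⟩

theorem star_continuous : Continuous (star : Completion A → Completion A) :=
  Completion.continuous_map

variable [NormedStarGroup A]

theorem coe_star (a : A) : ((star a : A) : Completion A) = star (a : Completion A) :=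
  (Completion.map_coe (starNormedAddGroupHom (E := A)).uniformContinuous a).symm

instance instStarRing : StarRing (Completion A) where
  star_involutive a := by
    induction a using Completion.induction_on with
    | hp => exact isClosed_eq (star_continuous.comp star_continuous) continuous_id
    | ih a => simp only [← coe_star, star_star]
  star_mul a b := by
    induction a, b using Completion.induction_on₂ with
    | hp => exact isClosed_eq (star_continuous.comp (by fun_prop))
              ((star_continuous.comp continuous_snd).mul (star_continuous.comp continuous_fst))
    | ih a b => simp only [← coe_star, ← nonUnital_coe_mul, star_mul]
  star_add a b := by
    induction a, b using Completion.induction_on₂ with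
    | hp => exact isClosed_eq (star_continuous.comp (by fun_prop))
              ((star_continuous.comp continuous_fst).add (star_continuous.comp continuous_snd))
    | ih a b => simp only [← coe_star, ← coe_add, star_add]

instance instNormedStarGroup : NormedStarGroup (Completion A) where
  norm_star_le a := by
    induction a using Completion.induction_on with
    | hp => exact isClosed_le star_continuous.norm continuous_norm
    | ih a => simp only [← coe_star, norm_coe, norm_star, le_refl]

instance instStarModule [NormedSpace ℂ A] [StarModule ℂ A] : StarModule ℂ (Completion A) where
  star_smul c a := by
    induction a using Completion.induction_on with
    | hp => exact isClosed_eq (star_continuous.comp (continuous_nonUnital_smul c))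
              ((continuous_nonUnital_smul (star c)).comp star_continuous)
    | ih a => simp only [← coe_smul, ← coe_star, star_smul]

end NonUnital

end UniformSpace.Completion

/-! ### The Banach algebra completing a normed star-algebra -/

/-- The completion of a (not necessarily unital) normed algebra. -/
def BanachCompletion (A : Type u) [NonUnitalNormedRing A] : Type u := Completion A

namespace BanachCompletion

section

variable {A : Type u} [NonUnitalNormedRing A]

instance : NonUnitalNormedRing (BanachCompletion A) :=
  inferInstanceAs (NonUnitalNormedRing (Completion A))

instance : CompleteSpace (BanachCompletion A) := inferInstanceAs (CompleteSpace (Completion A))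

instance [NormedSpace ℂ A] : NormedSpace ℂ (BanachCompletion A) :=
  inferInstanceAs (NormedSpace ℂ (Completion A))

instance [NormedSpace ℂ A] [IsScalarTower ℂ A A] :
    IsScalarTower ℂ (BanachCompletion A) (BanachCompletion A) :=
  Completion.nonUnitalIsScalarTower

instance [NormedSpace ℂ A] [SMulCommClass ℂ A A] :
    SMulCommClass ℂ (BanachCompletion A) (BanachCompletion A) :=
  Completion.nonUnitalSMulCommClass

instance [StarRing A] [NormedStarGroup A] : StarRing (BanachCompletion A) :=
  inferInstanceAs (StarRing (Completion A))

instance [StarRing A] [NormedStarGroup A] : NormedStarGroup (BanachCompletion A) :=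
  Completion.instNormedStarGroup

instance [NormedSpace ℂ A] [StarRing A] [NormedStarGroup A] [StarModule ℂ A] :
    StarModule ℂ (BanachCompletion A) :=
  Completion.instStarModule

end

variable {A B : Type u} [NonUnitalNormedRing A] [NormedSpace ℂ A] [StarRing A] [NormedStarGroup A]
  [NonUnitalNormedRing B] [NormedSpace ℂ B] [StarRing B] [NormedStarGroup B]

/-- The canonical inclusion of `A` in its completion. -/
def of (A : Type u) [NonUnitalNormedRing A] [NormedSpace ℂ A] [StarRing A] [NormedStarGroup A] :
    A →⋆ₙₐ[ℂ] BanachCompletion A where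
  toFun a := (a : Completion A)
  map_smul' c a := Completion.coe_smul c a
  map_zero' := Completion.coe_zero
  map_add' a b := Completion.coe_add a b
  map_mul' a b := Completion.nonUnital_coe_mul a b
  map_star' a := Completion.coe_star a

theorem norm_of (a : A) : ‖of A a‖ = ‖a‖ := Completion.norm_coe a

theorem denseRange_of : DenseRange (of A) := Completion.denseRange_coe

theorem continuous_of : Continuous (of A) := Completion.continuous_coe A

/-- The underlying function of `map`. -/
def mapFun (φ : A →⋆ₙₐ[ℂ] B) : BanachCompletion A → BanachCompletion B := Completion.map φ

theorem continuous_mapFun (φ : A →⋆ₙₐ[ℂ] B) : Continuous (mapFun φ) := Completion.continuous_map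

theorem mapFun_of (φ : A →⋆ₙₐ[ℂ] B) (hφ : ∀ a, ‖φ a‖ ≤ ‖a‖) (a : A) :
    mapFun φ (of A a) = of B (φ a) :=
  Completion.map_coe (AddMonoidHomClass.uniformContinuous_of_bound φ 1 (by simpa using hφ)) a

/-- The continuous extension of a contractive `*`-homomorphism to the completions. -/
def map (φ : A →⋆ₙₐ[ℂ] B) (hφ : ∀ a, ‖φ a‖ ≤ ‖a‖) : BanachCompletion A →⋆ₙₐ[ℂ] BanachCompletion B where
  toFun := mapFun φ
  map_smul' c x := by
    refine denseRange_of.induction_on (p := fun x => mapFun φ (c • x) = c • mapFun φ x) x ?_ ?_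
    · exact isClosed_eq ((continuous_mapFun φ).comp (continuous_const_smul c))
        ((continuous_mapFun φ).const_smul c)
    · intro a
      rw [← map_smul, mapFun_of φ hφ, mapFun_of φ hφ, map_smul, map_smul]
  map_zero' := by
    rw [← map_zero (of A), mapFun_of φ hφ, map_zero, map_zero]
  map_add' x y := by
    refine denseRange_of.induction_on₂
      (p := fun x y => mapFun φ (x + y) = mapFun φ x + mapFun φ y) ?_ ?_ x y
    · exact isClosed_eq ((continuous_mapFun φ).comp continuous_add)
        (((continuous_mapFun φ).comp continuous_fst).add
          ((continuous_mapFun φ).comp continuous_snd))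
    · intro a b
      rw [← map_add, mapFun_of φ hφ, mapFun_of φ hφ, mapFun_of φ hφ, map_add, map_add]
  map_mul' x y := by
    refine denseRange_of.induction_on₂
      (p := fun x y => mapFun φ (x * y) = mapFun φ x * mapFun φ y) ?_ ?_ x y
    · exact isClosed_eq ((continuous_mapFun φ).comp continuous_mul)
        (((continuous_mapFun φ).comp continuous_fst).mul
          ((continuous_mapFun φ).comp continuous_snd))
    · intro a b
      rw [← map_mul, mapFun_of φ hφ, mapFun_of φ hφ, mapFun_of φ hφ, map_mul, map_mul]
  map_star' x := by
    refine denseRange_of.induction_on (p := fun x => mapFun φ (star x) = star (mapFun φ x)) x ?_ ?_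
    · exact isClosed_eq ((continuous_mapFun φ).comp continuous_star)
        (continuous_mapFun φ).star
    · intro a
      rw [← map_star, mapFun_of φ hφ, mapFun_of φ hφ, map_star, map_star]

theorem continuous_map (φ : A →⋆ₙₐ[ℂ] B) (hφ : ∀ a, ‖φ a‖ ≤ ‖a‖) : Continuous (map φ hφ) :=
  continuous_mapFun φ

theorem map_of (φ : A →⋆ₙₐ[ℂ] B) (hφ : ∀ a, ‖φ a‖ ≤ ‖a‖) (a : A) :
    map φ hφ (of A a) = of B (φ a) := mapFun_of φ hφ a

end BanachCompletion

/-! ### Enveloping C*-algebras -/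

section Envelope

variable (A : Type u) [NonUnitalRing A] [Module ℂ A] [StarRing A]

/-- A `*`-representation of the complex `*`-algebra `A` by bounded operators on a Hilbert space. -/
structure HilbertRep where
  H : Type u
  [normed : NormedAddCommGroup H]
  [inner : InnerProductSpace ℂ H]
  [complete : CompleteSpace H]
  π : A →⋆ₙₐ[ℂ] (H →L[ℂ] H)

attribute [instance] HilbertRep.normed HilbertRep.inner HilbertRep.complete

/-- The enveloping (universal) C*-algebra of `A` exists: for every `a`, the supremum of `‖π(a)‖`
over all `*`-representations `π` of `A` on Hilbert spaces is finite. -/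
def HasEnvelope : Prop := ∀ a : A, BddAbove (Set.range fun ρ : HilbertRep A => ‖ρ.π a‖)

variable {A}

/-- The bounded elements of the product of the algebras `B(H)` over all `*`-representations of `A`
(a C*-algebra with the pointwise operations and the supremum norm). -/
def RepProduct (A : Type u) [NonUnitalRing A] [Module ℂ A] [StarRing A] : Type (u + 1) :=
  lp (fun ρ : HilbertRep A => ρ.H →L[ℂ] ρ.H) ∞

instance : NonUnitalNormedRing (RepProduct A) :=
  inferInstanceAs (NonUnitalNormedRing (lp (fun ρ : HilbertRep A => ρ.H →L[ℂ] ρ.H) ∞))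

instance : StarRing (RepProduct A) :=
  inferInstanceAs (StarRing (lp (fun ρ : HilbertRep A => ρ.H →L[ℂ] ρ.H) ∞))

instance : CStarRing (RepProduct A) :=
  inferInstanceAs (CStarRing (lp (fun ρ : HilbertRep A => ρ.H →L[ℂ] ρ.H) ∞))

instance : NormedSpace ℂ (RepProduct A) :=
  lp.instNormedSpace (𝕜 := ℂ) (E := fun ρ : HilbertRep A => ρ.H →L[ℂ] ρ.H) (p := ∞)

instance : CompleteSpace (RepProduct A) :=
  inferInstanceAs (CompleteSpace (lp (fun ρ : HilbertRep A => ρ.H →L[ℂ] ρ.H) ∞))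

instance : IsScalarTower ℂ (RepProduct A) (RepProduct A) :=
  lp.infty_isScalarTower (𝕜 := ℂ) (B := fun ρ : HilbertRep A => ρ.H →L[ℂ] ρ.H)

instance : SMulCommClass ℂ (RepProduct A) (RepProduct A) :=
  lp.infty_smulCommClass (𝕜 := ℂ) (B := fun ρ : HilbertRep A => ρ.H →L[ℂ] ρ.H)

instance : StarModule ℂ (RepProduct A) where
  star_smul c f := Subtype.ext <| funext fun ρ =>
    star_smul c ((show lp (fun ρ : HilbertRep A => ρ.H →L[ℂ] ρ.H) ∞ from f) ρ)

instance : NonUnitalCStarAlgebra (RepProduct A) where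

/-- The direct sum of all `*`-representations of `A`. -/
def universalRep (h : HasEnvelope A) : A →⋆ₙₐ[ℂ] RepProduct A where
  toFun a := (⟨fun ρ => ρ.π a, memℓp_infty (h a)⟩ :
    lp (fun ρ : HilbertRep A => ρ.H →L[ℂ] ρ.H) ∞)
  map_smul' c a := Subtype.ext <| funext fun ρ => map_smul ρ.π c a
  map_zero' := Subtype.ext <| funext fun ρ => map_zero ρ.π
  map_add' a b := Subtype.ext <| funext fun ρ => map_add ρ.π a b
  map_mul' a b := Subtype.ext <| funext fun ρ => map_mul ρ.π a b
  map_star' a := Subtype.ext <| funext fun ρ => map_star ρ.π a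

/-- The closure of the image of `A` under the direct sum of all `*`-representations. -/
def envelopeSubalgebra (h : HasEnvelope A) : NonUnitalStarSubalgebra ℂ (RepProduct A) :=
  (NonUnitalStarAlgHom.range (universalRep h)).topologicalClosure

/-- The enveloping C*-algebra of `A`: the closure of the image of `A` under the direct sum of all
`*`-representations, i.e. the Hausdorff completion of `A` in the seminorm `sup_π ‖π(a)‖`. -/
def CStarEnvelope (h : HasEnvelope A) : Type (u + 1) := envelopeSubalgebra h

instance (h : HasEnvelope A) : NonUnitalCStarAlgebra (CStarEnvelope h) :=
  NonUnitalStarSubalgebra.nonUnitalCStarAlgebra (envelopeSubalgebra h)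
    (h_closed := NonUnitalStarSubalgebra.isClosed_topologicalClosure _)

/-- The inclusion of the enveloping C*-algebra in the product of all representations. -/
def CStarEnvelope.val (h : HasEnvelope A) : CStarEnvelope h →⋆ₙₐ[ℂ] RepProduct A where
  toFun x := Subtype.val (p := (· ∈ envelopeSubalgebra h)) x
  map_smul' _ _ := rfl
  map_zero' := rfl
  map_add' _ _ := rfl
  map_mul' _ _ := rfl
  map_star' _ := rfl

/-- A `*`-homomorphism to the product of all representations with values in the enveloping
C*-algebra. -/
def CStarEnvelope.codRestrict {B : Type*} [NonUnitalRing B] [Module ℂ B] [StarRing B]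
    (h : HasEnvelope A) (φ : B →⋆ₙₐ[ℂ] RepProduct A) (hφ : ∀ b, φ b ∈ envelopeSubalgebra h) :
    B →⋆ₙₐ[ℂ] CStarEnvelope h where
  toFun b := (⟨φ b, hφ b⟩ : envelopeSubalgebra h)
  map_smul' c b := Subtype.ext (map_smul φ c b)
  map_zero' := Subtype.ext (map_zero φ)
  map_add' a b := Subtype.ext (map_add φ a b)
  map_mul' a b := Subtype.ext (map_mul φ a b)
  map_star' b := Subtype.ext (map_star φ b)

/-- The canonical `*`-homomorphism from `A` to its enveloping C*-algebra. -/
def toEnvelope (h : HasEnvelope A) : A →⋆ₙₐ[ℂ] CStarEnvelope h :=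
  CStarEnvelope.codRestrict h (universalRep h) fun a =>
    NonUnitalStarSubalgebra.le_topologicalClosure _ ⟨a, rfl⟩

end Envelope

section Functoriality

variable {A B : Type u} [NonUnitalRing A] [Module ℂ A] [StarRing A] [NonUnitalRing B] [Module ℂ B]
  [StarRing B]

/-- The pullback of a `*`-representation along a `*`-homomorphism. -/
def HilbertRep.pullback (φ : A →⋆ₙₐ[ℂ] B) (σ : HilbertRep B) : HilbertRep A where
  H := σ.H
  π := σ.π.comp φ

/-- The `*`-homomorphism of representation products whose component at a representation `σ` of `B`
is the component at the pullback of `σ` to `A`. -/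
def RepProduct.map (φ : A →⋆ₙₐ[ℂ] B) : RepProduct A →⋆ₙₐ[ℂ] RepProduct B where
  toFun f := (⟨fun σ => (f.1 (σ.pullback φ) : σ.H →L[ℂ] σ.H), memℓp_infty (by
    obtain ⟨C, hC⟩ := memℓp_infty_iff.mp f.2
    refine ⟨C, ?_⟩
    rintro _ ⟨σ, rfl⟩
    exact hC ⟨σ.pullback φ, rfl⟩)⟩ : lp (fun σ : HilbertRep B => σ.H →L[ℂ] σ.H) ∞)
  map_smul' _ _ := rfl
  map_zero' := rfl
  map_add' _ _ := rfl
  map_mul' _ _ := rfl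
  map_star' _ := rfl

theorem RepProduct.map_universalRep (φ : A →⋆ₙₐ[ℂ] B) (hA : HasEnvelope A) (hB : HasEnvelope B)
    (a : A) : RepProduct.map φ (universalRep hA a) = universalRep hB (φ a) := rfl

theorem RepProduct.norm_map_le (φ : A →⋆ₙₐ[ℂ] B) (f : RepProduct A) :
    ‖RepProduct.map φ f‖ ≤ ‖f‖ :=
  lp.norm_le_of_forall_le (norm_nonneg f) fun σ =>
    lp.norm_apply_le_norm ENNReal.top_ne_zero
      (show lp (fun ρ : HilbertRep A => ρ.H →L[ℂ] ρ.H) ∞ from f) (σ.pullback φ)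

theorem RepProduct.continuous_map (φ : A →⋆ₙₐ[ℂ] B) : Continuous (RepProduct.map φ) :=
  AddMonoidHomClass.continuous_of_bound (RepProduct.map φ) 1 fun f => by
    simpa using RepProduct.norm_map_le φ f

theorem RepProduct.map_mem (φ : A →⋆ₙₐ[ℂ] B) (hA : HasEnvelope A) (hB : HasEnvelope B)
    {f : RepProduct A} (hf : f ∈ envelopeSubalgebra hA) :
    RepProduct.map φ f ∈ envelopeSubalgebra hB := by
  change f ∈ closure (Set.range (universalRep hA)) at hf
  change RepProduct.map φ f ∈ closure (Set.range (universalRep hB))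
  refine map_mem_closure (RepProduct.continuous_map φ) hf ?_
  rintro _ ⟨a, rfl⟩
  exact ⟨φ a, rfl⟩

/-- The natural `*`-homomorphism of enveloping C*-algebras induced by a `*`-homomorphism `φ`, i.e.
the continuous extension of `φ`. -/
def envelopeMap (φ : A →⋆ₙₐ[ℂ] B) (hA : HasEnvelope A) (hB : HasEnvelope B) :
    CStarEnvelope hA →⋆ₙₐ[ℂ] CStarEnvelope hB :=
  CStarEnvelope.codRestrict hB ((RepProduct.map φ).comp (CStarEnvelope.val hA)) fun x =>
    RepProduct.map_mem φ hA hB (Subtype.property (p := (· ∈ envelopeSubalgebra hA)) x)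

theorem envelopeMap_toEnvelope (φ : A →⋆ₙₐ[ℂ] B) (hA : HasEnvelope A) (hB : HasEnvelope B) (a : A) :
    envelopeMap φ hA hB (toEnvelope hA a) = toEnvelope hB (φ a) := rfl

theorem continuous_envelopeMap (φ : A →⋆ₙₐ[ℂ] B) (hA : HasEnvelope A) (hB : HasEnvelope B) :
    Continuous (envelopeMap φ hA hB) := by
  have h : Continuous fun x : envelopeSubalgebra hA => RepProduct.map φ (x : RepProduct A) :=
    (RepProduct.continuous_map φ).comp continuous_subtype_val
  exact h.subtype_mk (p := (· ∈ envelopeSubalgebra hB)) fun x => RepProduct.map_mem φ hA hB x.2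

theorem denseRange_toEnvelope (hA : HasEnvelope A) : DenseRange (toEnvelope hA) := by
  have key : DenseRange (fun a : A => (⟨universalRep hA a,
      NonUnitalStarSubalgebra.le_topologicalClosure _ ⟨a, rfl⟩⟩ : envelopeSubalgebra hA)) := by
    rintro ⟨x, hx⟩
    rw [closure_subtype, ← Set.range_comp]
    exact hx
  exact key

theorem envelopeMap_eq_of_forall (φ : A →⋆ₙₐ[ℂ] B) (hA : HasEnvelope A) (hB : HasEnvelope B)
    (p : B) (hp : ∀ a, φ a = p * φ a * p) (x : CStarEnvelope hA) :
    envelopeMap φ hA hB x = toEnvelope hB p * envelopeMap φ hA hB x * toEnvelope hB p := by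
  have hc : Continuous (envelopeMap φ hA hB) := continuous_envelopeMap φ hA hB
  have hclosed : IsClosed {x | envelopeMap φ hA hB x =
      toEnvelope hB p * envelopeMap φ hA hB x * toEnvelope hB p} :=
    isClosed_eq hc ((continuous_const.mul hc).mul continuous_const)
  refine (denseRange_toEnvelope hA).induction_on
    (p := fun x => envelopeMap φ hA hB x =
      toEnvelope hB p * envelopeMap φ hA hB x * toEnvelope hB p) x hclosed fun y => ?_
  rw [envelopeMap_toEnvelope, ← map_mul, ← map_mul, ← hp]

end Functoriality

/-- Every `*`-representation of a Banach `*`-algebra with isometric involution is contractive. -/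
theorem norm_rep_le {A : Type u} [NonUnitalNormedRing A] [CompleteSpace A] [NormedSpace ℂ A]
    [IsScalarTower ℂ A A] [SMulCommClass ℂ A A] [StarRing A] [NormedStarGroup A]
    (ρ : HilbertRep A) (a : A) : ‖ρ.π a‖ ≤ ‖a‖ := by
  have key : ∀ b : A, IsSelfAdjoint b → ‖ρ.π b‖ ≤ ‖b‖ := by
    intro b hb
    have hsa : IsSelfAdjoint (ρ.π b) := hb.map ρ.π
    let φ : Unitization ℂ A →ₐ[ℂ] (ρ.H →L[ℂ] ρ.H) := Unitization.lift ρ.π.toNonUnitalAlgHom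
    have h1 : φ (b : Unitization ℂ A) = ρ.π b := by simp [φ]
    let ψ : WithLp 1 (Unitization ℂ A) →ₐ[ℂ] (ρ.H →L[ℂ] ρ.H) :=
      φ.comp (WithLp.unitizationAlgEquiv (𝕜 := ℂ) (A := A) ℂ).toAlgHom
    have h2 : ψ (WithLp.toLp 1 (b : Unitization ℂ A)) = ρ.π b := h1
    have h0 : ‖(1 : WithLp 1 (Unitization ℂ A))‖ = 1 := by
      have : (WithLp.ofLp (1 : WithLp 1 (Unitization ℂ A))) = 1 := rfl
      rw [WithLp.unitization_norm_def, this]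
      simp
    have : NormOneClass (WithLp 1 (Unitization ℂ A)) := ⟨h0⟩
    have h3 := AlgHom.spectrum_apply_subset ψ (WithLp.toLp 1 (b : Unitization ℂ A))
    rw [h2] at h3
    have h4 : spectralRadius ℂ (ρ.π b) ≤
        spectralRadius ℂ (WithLp.toLp 1 (b : Unitization ℂ A)) :=
      biSup_mono fun _ hx => h3 hx
    rw [hsa.spectralRadius_eq_nnnorm] at h4
    have h5 := h4.trans (spectrum.spectralRadius_le_nnnorm _)
    rw [ENNReal.coe_le_coe, ← NNReal.coe_le_coe, coe_nnnorm, coe_nnnorm,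
      WithLp.unitization_norm_inr] at h5
    exact h5
  have h := key (star a * a) (IsSelfAdjoint.star_mul_self a)
  rw [map_mul, map_star, CStarRing.norm_star_mul_self] at h
  have h' : ‖star a * a‖ ≤ ‖a‖ * ‖a‖ := by simpa using norm_mul_le (star a) a
  exact abs_le_of_sq_le_sq' (by nlinarith) (norm_nonneg a) |>.2

/-- The enveloping C*-algebra of a Banach `*`-algebra with isometric involution exists. -/
theorem hasEnvelope_of_banach (A : Type u) [NonUnitalNormedRing A] [CompleteSpace A]
    [NormedSpace ℂ A] [IsScalarTower ℂ A A] [SMulCommClass ℂ A A] [StarRing A]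
    [NormedStarGroup A] : HasEnvelope A := fun a =>
  ⟨‖a‖, by rintro _ ⟨ρ, rfl⟩; exact norm_rep_le ρ a⟩

section Corner

variable {B : Type*} [NonUnitalRing B] [Module ℂ B] [IsScalarTower ℂ B B] [SMulCommClass ℂ B B]
  [StarRing B] [StarModule ℂ B]

/-- The corner `p B p` for a self-adjoint element `p` of `B`. -/
def corner (p : B) (hp : IsSelfAdjoint p) : NonUnitalStarSubalgebra ℂ B where
  carrier := {y | ∃ x, y = p * x * p}
  zero_mem' := ⟨0, by simp⟩
  add_mem' := by
    rintro _ _ ⟨x, rfl⟩ ⟨y, rfl⟩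
    exact ⟨x + y, by simp [mul_add, add_mul]⟩
  mul_mem' := by
    rintro _ _ ⟨x, rfl⟩ ⟨y, rfl⟩
    exact ⟨x * p * p * y, by simp only [mul_assoc]⟩
  smul_mem' := by
    rintro c _ ⟨x, rfl⟩
    exact ⟨c • x, by rw [mul_smul_comm, smul_mul_assoc]⟩
  star_mem' := by
    rintro _ ⟨x, rfl⟩
    exact ⟨star x, by simp [hp.star_eq, mul_assoc]⟩

end Corner

/-! ### The convolution algebra `C_c(G)` of a unimodular group -/

section Convolution

variable {G : Type u} [Group G] [TopologicalSpace G] [IsTopologicalGroup G]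
  [MeasurableSpace G] [BorelSpace G]

/-- The vector space `C_c(G)` of compactly supported continuous functions `G → ℂ`, to be equipped
with the convolution product, the involution and the `L^1`-norm of the Haar measure `μ`. -/
def ConvAlg (_μ : Measure G) : Type u := C_c(G, ℂ)

namespace ConvAlg

variable {μ : Measure G}

instance : AddCommGroup (ConvAlg μ) := inferInstanceAs (AddCommGroup C_c(G, ℂ))

instance : Module ℂ (ConvAlg μ) := inferInstanceAs (Module ℂ C_c(G, ℂ))

instance : FunLike (ConvAlg μ) G ℂ := inferInstanceAs (FunLike C_c(G, ℂ) G ℂ)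

/-- A compactly supported continuous function, as an element of the convolution algebra. -/
def mk (f : G → ℂ) (hc : Continuous f) (hs : HasCompactSupport f) : ConvAlg μ :=
  (⟨⟨f, hc⟩, hs⟩ : C_c(G, ℂ))

@[simp] theorem mk_apply (f : G → ℂ) (hc : Continuous f) (hs : HasCompactSupport f) (g : G) :
    (mk f hc hs : ConvAlg μ) g = f g := rfl

@[ext] theorem ext {f₁ f₂ : ConvAlg μ} (h : ∀ g, f₁ g = f₂ g) : f₁ = f₂ := DFunLike.ext _ _ h

@[simp] theorem zero_apply (g : G) : (0 : ConvAlg μ) g = 0 := rfl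
@[simp] theorem add_apply (f₁ f₂ : ConvAlg μ) (g : G) : (f₁ + f₂) g = f₁ g + f₂ g := rfl
@[simp] theorem neg_apply (f : ConvAlg μ) (g : G) : (-f) g = -f g := rfl
@[simp] theorem smul_apply (c : ℂ) (f : ConvAlg μ) (g : G) : (c • f) g = c * f g := rfl

theorem continuous (f : ConvAlg μ) : Continuous f := (show C_c(G, ℂ) from f).continuous

theorem hasCompactSupport (f : ConvAlg μ) : HasCompactSupport f :=
  (show C_c(G, ℂ) from f).hasCompactSupport'

theorem hasCompactSupport_kernel {f₁ f₂ : G → ℂ} (h₁ : HasCompactSupport f₁)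
    (h₂ : HasCompactSupport f₂) :
    HasCompactSupport (fun p : G × G => f₁ p.2 * f₂ (p.2⁻¹ * p.1)) := by
  have hK : IsCompact ((fun q : G × G => (q.1 * q.2, q.1)) '' (tsupport f₁ ×ˢ tsupport f₂)) :=
    (h₁.prod h₂).image (by fun_prop)
  refine HasCompactSupport.intro' (hK.closure) isClosed_closure ?_
  rintro ⟨g, h⟩ hgh
  by_contra hne
  apply hgh
  refine subset_closure ⟨(h, h⁻¹ * g), ⟨subset_tsupport _ ?_, subset_tsupport _ ?_⟩, by simp⟩
  · exact fun h0 => hne (by simp [h0])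
  · exact fun h0 => hne (by simp [h0])

variable [μ.IsHaarMeasure]

theorem continuous_conv (f₁ f₂ : ConvAlg μ) :
    Continuous fun g => ∫ h, f₁ h * f₂ (h⁻¹ * g) ∂μ := by
  rw [← continuousOn_univ]
  refine continuousOn_integral_of_compact_support (k := tsupport f₁)
    (f := fun g h => f₁ h * f₂ (h⁻¹ * g)) f₁.hasCompactSupport ?_ ?_
  · have h1 := f₁.continuous
    have h2 := f₂.continuous
    exact Continuous.continuousOn (by simp only [Function.uncurry_def]; fun_prop)
  · intro g h _ hh
    rw [image_eq_zero_of_notMem_tsupport hh, zero_mul]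

theorem hasCompactSupport_conv (f₁ f₂ : ConvAlg μ) :
    HasCompactSupport fun g => ∫ h, f₁ h * f₂ (h⁻¹ * g) ∂μ := by
  refine HasCompactSupport.intro'
    ((hasCompactSupport_kernel f₁.hasCompactSupport f₂.hasCompactSupport).isCompact.image
      continuous_fst).closure isClosed_closure ?_
  intro g hg
  refine integral_eq_zero_of_ae (Filter.Eventually.of_forall fun h => ?_)
  by_contra hne
  exact hg (subset_closure ⟨(g, h), subset_tsupport _ hne, rfl⟩)

/-- Convolution `(f₁ * f₂)(g) = ∫ f₁(h) f₂(h⁻¹ g) dμ(h)`. -/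
instance : Mul (ConvAlg μ) :=
  ⟨fun f₁ f₂ => mk (fun g => ∫ h, f₁ h * f₂ (h⁻¹ * g) ∂μ) (continuous_conv f₁ f₂)
    (hasCompactSupport_conv f₁ f₂)⟩

theorem mul_apply (f₁ f₂ : ConvAlg μ) (g : G) :
    (f₁ * f₂) g = ∫ h, f₁ h * f₂ (h⁻¹ * g) ∂μ := rfl

/-- Involution `f*(g) = conj (f(g⁻¹))` (the modular function of a unimodular group is `1`). -/
instance : Star (ConvAlg μ) :=
  ⟨fun f => mk (fun g => star (f g⁻¹)) (f.continuous.comp continuous_inv).star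
    ((f.hasCompactSupport.comp_homeomorph (Homeomorph.inv G)).comp_left (g := star) (star_zero ℂ))⟩

theorem star_apply (f : ConvAlg μ) (g : G) : (star f) g = star (f g⁻¹) := rfl

theorem integrable_kernel (f₁ f₂ : ConvAlg μ) (g : G) :
    Integrable (fun h => f₁ h * f₂ (h⁻¹ * g)) μ := by
  have h1 := f₁.continuous
  have h2 := f₂.continuous
  exact Continuous.integrable_of_hasCompactSupport (by fun_prop) f₁.hasCompactSupport.mul_right

theorem integral_translate_swap {F : Type*} [NormedAddCommGroup F] [NormedSpace ℝ F]
    (k : G → G → F) (hk : Continuous k.uncurry) (hs : HasCompactSupport k.uncurry) :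
    ∫ h, ∫ k', k h k' ∂μ ∂μ = ∫ k', ∫ h, k (k' * h) k' ∂μ ∂μ := by
  rw [integral_integral_swap_of_hasCompactSupport hk hs]
  congr 1 with k'
  exact (integral_mul_left_eq_self (fun h => k h k') k').symm

instance : NonUnitalRing (ConvAlg μ) where
  zero_mul f := by ext g; simp [mul_apply]
  mul_zero f := by ext g; simp [mul_apply]
  left_distrib f₁ f₂ f₃ := by
    ext g
    simp only [mul_apply, add_apply, mul_add]
    exact integral_add (integrable_kernel f₁ f₂ g) (integrable_kernel f₁ f₃ g)
  right_distrib f₁ f₂ f₃ := by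
    ext g
    simp only [mul_apply, add_apply, add_mul]
    exact integral_add (integrable_kernel f₁ f₃ g) (integrable_kernel f₂ f₃ g)
  mul_assoc f₁ f₂ f₃ := by
    ext g
    simp only [mul_apply, ← integral_mul_const, ← integral_const_mul]
    have c1 := f₁.continuous
    have c2 := f₂.continuous
    have c3 := f₃.continuous
    rw [integral_translate_swap (fun h k => f₁ k * f₂ (k⁻¹ * h) * f₃ (h⁻¹ * g))]
    · simp [mul_assoc]
    · simp only [Function.uncurry_def]; fun_prop
    · exact (hasCompactSupport_kernel f₁.hasCompactSupport f₂.hasCompactSupport).mul_right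

instance : StarRing (ConvAlg μ) where
  star_involutive f := by ext g; simp [star_apply]
  star_add f₁ f₂ := by ext g; simp [star_apply]
  star_mul f₁ f₂ := by
    ext g
    simp only [star_apply, mul_apply]
    rw [← integral_mul_left_eq_self _ g⁻¹]
    simp only [RCLike.star_def, ← integral_conj]
    congr 1 with h
    simp [mul_comm]

instance : IsScalarTower ℂ (ConvAlg μ) (ConvAlg μ) where
  smul_assoc c f₁ f₂ := by
    ext g; simp [mul_apply, mul_assoc, integral_const_mul]

instance : SMulCommClass ℂ (ConvAlg μ) (ConvAlg μ) where
  smul_comm c f₁ f₂ := by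
    ext g; simp [mul_apply, mul_left_comm _ c, integral_const_mul]

instance : StarModule ℂ (ConvAlg μ) where
  star_smul c f := by ext g; simp [star_apply]

instance : Norm (ConvAlg μ) := ⟨fun f => ∫ g, ‖f g‖ ∂μ⟩

/-- The `L^1`-norm. -/
theorem norm_def (f : ConvAlg μ) : ‖f‖ = ∫ g, ‖f g‖ ∂μ := rfl

theorem integrable_norm (f : ConvAlg μ) : Integrable (fun g => ‖f g‖) μ :=
  (f.continuous.integrable_of_hasCompactSupport f.hasCompactSupport).norm

theorem norm_core : NormedSpace.Core ℂ (ConvAlg μ) where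
  norm_nonneg f := integral_nonneg fun _ => norm_nonneg _
  norm_smul c f := by simp [norm_def, integral_const_mul]
  norm_triangle f₁ f₂ := by
    simp only [norm_def]
    rw [← integral_add f₁.integrable_norm f₂.integrable_norm]
    exact integral_mono (f₁ + f₂).integrable_norm (f₁.integrable_norm.add f₂.integrable_norm)
      fun g => norm_add_le _ _
  norm_eq_zero_iff f := by
    refine ⟨fun h => ?_, fun h => by simp [h, norm_def]⟩
    by_contra hne
    obtain ⟨g, hg⟩ : ∃ g, f g ≠ 0 := by
      by_contra! h0
      exact hne (ext h0)
    exact (f.continuous.norm.integral_pos_of_hasCompactSupport_nonneg_nonzero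
      f.hasCompactSupport.norm (fun _ => norm_nonneg _) (norm_ne_zero_iff.mpr hg)).ne' h

instance : NormedAddCommGroup (ConvAlg μ) := NormedAddCommGroup.ofCore norm_core

instance : NonUnitalNormedRing (ConvAlg μ) where
  __ : NonUnitalRing (ConvAlg μ) := inferInstance
  __ : NormedAddCommGroup (ConvAlg μ) := inferInstance
  norm_mul_le f₁ f₂ := by
    simp only [norm_def, mul_apply]
    have c1 := f₁.continuous
    have c2 := f₂.continuous
    have hk := hasCompactSupport_kernel f₁.hasCompactSupport f₂.hasCompactSupport
    have hkc : Continuous (fun p : G × G => f₁ p.2 * f₂ (p.2⁻¹ * p.1)) := by fun_prop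
    calc ∫ g, ‖∫ h, f₁ h * f₂ (h⁻¹ * g) ∂μ‖ ∂μ
        ≤ ∫ g, ∫ h, ‖f₁ h * f₂ (h⁻¹ * g)‖ ∂μ ∂μ := by
          refine integral_mono_of_nonneg (Filter.Eventually.of_forall fun _ => norm_nonneg _) ?_
            (Filter.Eventually.of_forall fun _ => norm_integral_le_integral_norm _)
          have hc : Continuous fun g => ∫ h, ‖f₁ h * f₂ (h⁻¹ * g)‖ ∂μ := by
            rw [← continuousOn_univ]
            refine continuousOn_integral_of_compact_support (k := tsupport f₁)
              (f := fun g h => ‖f₁ h * f₂ (h⁻¹ * g)‖) f₁.hasCompactSupport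
              hkc.norm.continuousOn ?_
            intro g h _ hh
            rw [image_eq_zero_of_notMem_tsupport hh, zero_mul, norm_zero]
          refine hc.integrable_of_hasCompactSupport (HasCompactSupport.intro'
            (hk.isCompact.image continuous_fst).closure isClosed_closure fun g hg => ?_)
          refine integral_eq_zero_of_ae (Filter.Eventually.of_forall fun h => ?_)
          by_contra hne
          exact hg (subset_closure ⟨(g, h), subset_tsupport _
            (fun h0 => hne (by simpa using h0)), rfl⟩)
      _ = ∫ h, ∫ g, ‖f₁ h * f₂ g‖ ∂μ ∂μ := by
          rw [integral_translate_swap (fun g h => ‖f₁ h * f₂ (h⁻¹ * g)‖) hkc.norm hk.norm]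
          simp
      _ = (∫ g, ‖f₁ g‖ ∂μ) * ∫ g, ‖f₂ g‖ ∂μ := by
          simp only [norm_mul, integral_const_mul, integral_mul_const]

instance : NormedSpace ℂ (ConvAlg μ) := NormedSpace.ofCore norm_core

theorem integral_inv_of_unimodular [μ.IsMulRightInvariant] (f : G → ℝ) (hf : Continuous f)
    (hs : HasCompactSupport f) : ∫ g, f g⁻¹ ∂μ = ∫ g, f g ∂μ := by
  have key := fun (k : G → ℝ) (h : Continuous k) (h' : HasCompactSupport k) =>
    Measure.integral_isMulLeftInvariant_eq_smul_of_hasCompactSupport μ.inv μ h h'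
  set c := Measure.haarScalarFactor μ.inv μ
  have hinv : ∀ k : G → ℝ, ∫ g, k g ∂μ.inv = ∫ g, k g⁻¹ ∂μ := fun k =>
    integral_map_equiv (MeasurableEquiv.inv G) k
  have h1 := key f hf hs
  have h2 := key _ (hf.comp continuous_inv) (hs.comp_homeomorph (Homeomorph.inv G))
  rw [hinv, integral_smul_nnreal_measure] at h1 h2
  simp only [Function.comp_apply, inv_inv, NNReal.smul_def, smul_eq_mul] at h1 h2
  have hc : (0 : ℝ) ≤ c := c.2
  have : (1 + (c : ℝ)) * (∫ g, f g⁻¹ ∂μ - ∫ g, f g ∂μ) = 0 := by linarith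
  rcases mul_eq_zero.mp this with h | h <;> linarith

instance [μ.IsMulRightInvariant] : NormedStarGroup (ConvAlg μ) where
  norm_star_le f := by
    simp only [norm_def, star_apply, norm_star]
    exact (integral_inv_of_unimodular (fun g => ‖f g‖) f.continuous.norm
      f.hasCompactSupport.norm).le

end ConvAlg

end Convolution

/-! ### Hecke algebras, spherical functions and Gelfand pairs -/

section Hecke

variable {G : Type u} [Group G] [TopologicalSpace G] [IsTopologicalGroup G]
  [MeasurableSpace G] [BorelSpace G] (μ : Measure G) [μ.IsHaarMeasure] (U : OpenSubgroup G)

/-- The Hecke algebra `H(G, U)`: the compactly supported `U`-biinvariant functions on `G` with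
convolution and involution. (Biinvariant functions are continuous since `U` is open; for `U`
compact with `μ(U) = 1` the convolution integral is the sum over `G/U`, and compact support means
finite support on `U\G/U`.) -/
def heckeAlg : NonUnitalStarSubalgebra ℂ (ConvAlg μ) where
  carrier := {f | ∀ u ∈ U, ∀ g, f (u * g) = f g ∧ f (g * u) = f g}
  zero_mem' _ _ _ := ⟨rfl, rfl⟩
  add_mem' h₁ h₂ u hu g := by
    simp only [ConvAlg.add_apply, (h₁ u hu g).1, (h₁ u hu g).2, (h₂ u hu g).1, (h₂ u hu g).2,
      and_self]
  smul_mem' c f h u hu g := by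
    simp only [ConvAlg.smul_apply, (h u hu g).1, (h u hu g).2, and_self]
  mul_mem' {f₁ f₂} h₁ h₂ u hu g := by
    simp only [ConvAlg.mul_apply]
    constructor
    · rw [← integral_mul_left_eq_self _ u]
      congr 1 with h
      rw [(h₁ u hu h).1]
      simp [mul_assoc]
    · congr 1 with h
      rw [← mul_assoc, (h₂ u hu _).2]
  star_mem' {f} h u hu g := by
    simp only [ConvAlg.star_apply, mul_inv_rev, (h u⁻¹ (inv_mem hu) _).1,
      (h u⁻¹ (inv_mem hu) _).2, and_self]

/-- The Banach algebra `L¹(G)`, as the completion of `C_c(G)` in the `L¹`-norm. -/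
abbrev L1Group : Type u := BanachCompletion (ConvAlg μ)

/-- The Banach algebra `L¹(G, U)`: the completion of `H(G, U)` in the `L¹`-norm. -/
abbrev L1Hecke : Type u := BanachCompletion (heckeAlg μ U)

/-- `(G, U)` is a Gelfand pair if `L¹(G, U)` is commutative. -/
def IsGelfandPair : Prop := ∀ a b : L1Hecke μ U, a * b = b * a

/-- Spherical functions of `G` relative to `U`; here `∫_U` is integration over the open subgroup
`U` with respect to the restriction of `μ` (normalised by `μ(U) = 1`). -/
structure IsSpherical (ω : G → ℂ) : Prop where
  continuous : Continuous ω
  map_one : ω 1 = 1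
  biinvariant : ∀ u₁ ∈ U, ∀ u₂ ∈ U, ∀ g, ω (u₁ * g * u₂) = ω g
  integral_eq : ∀ g₁ g₂, ∫ u in (U : Set G), ω (g₁ * u * g₂) ∂μ = ω g₁ * ω g₂

/-- `*`-spherical functions. -/
structure IsStarSpherical (ω : G → ℂ) : Prop extends IsSpherical μ U ω where
  map_inv : ∀ g, ω g⁻¹ = star (ω g)

/-- Positive definite functions on a group. -/
def IsPositiveDefinite {G : Type u} [Group G] (ω : G → ℂ) : Prop :=
  ∀ (m : ℕ) (s : Fin m → G) (z : Fin m → ℂ),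
    0 ≤ ∑ j, ∑ k, ω ((s j)⁻¹ * s k) * star (z j) * z k

variable [μ.IsMulRightInvariant]

instance : NormedStarGroup (heckeAlg μ U) where
  norm_star_le f := (norm_star (f : ConvAlg μ)).le

/-- `C*(L¹(G, U))`. -/
abbrev CStarL1Hecke := CStarEnvelope (hasEnvelope_of_banach (L1Hecke μ U))

/-- The group C*-algebra `C*(G)`, the enveloping C*-algebra of `L¹(G)`. -/
abbrev CStarGroup := CStarEnvelope (hasEnvelope_of_banach (L1Group μ))

/-- The canonical inclusion of `H(G, U)` in `L¹(G, U)`. -/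
abbrev heckeToL1 : heckeAlg μ U →⋆ₙₐ[ℂ] L1Hecke μ U := BanachCompletion.of (heckeAlg μ U)

/-- The canonical inclusion of `L¹(G, U)` in `L¹(G)`: the continuous extension of the inclusion
of `H(G, U)` in `C_c(G)`. -/
def l1HeckeToL1Group : L1Hecke μ U →⋆ₙₐ[ℂ] L1Group μ :=
  BanachCompletion.map (NonUnitalStarSubalgebraClass.subtype (heckeAlg μ U)) fun _ => le_rfl

variable {U} (hU : IsCompact (U : Set G))

/-- The indicator function `χ_U` in `C_c(G)`. -/
def chi : ConvAlg μ :=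
  ConvAlg.mk ((U : Set G).indicator fun _ => 1)
    (Continuous.indicator (by simp [U.isClopen.frontier_eq]) continuous_const)
    (HasCompactSupport.intro' hU U.isClosed fun _ hg => Set.indicator_of_notMem hg _)

theorem chi_apply (g : G) : chi μ hU g = (U : Set G).indicator (fun _ => (1 : ℂ)) g := rfl

theorem star_chi : star (chi μ hU) = chi μ hU := by
  ext g
  by_cases hg : g ∈ U <;> simp [ConvAlg.star_apply, chi_apply, hg]

/-- The element `p₀ = χ_U` of `C*(G)`. -/
def p₀ : CStarGroup μ := toEnvelope _ (BanachCompletion.of (ConvAlg μ) (chi μ hU))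

theorem isSelfAdjoint_p₀ : IsSelfAdjoint (p₀ μ hU) := by
  rw [isSelfAdjoint_iff, p₀, ← map_star, ← map_star, star_chi]

/-- The corner `p₀ C*(G) p₀`. -/
abbrev cornerGroup : NonUnitalStarSubalgebra ℂ (CStarGroup μ) :=
  corner (p₀ μ hU) (isSelfAdjoint_p₀ μ hU)

theorem chi_mul (hμ : μ U = 1) (f : heckeAlg μ U) : chi μ hU * (f : ConvAlg μ) = f := by
  ext g
  have : ∀ h, chi μ hU h * (f : ConvAlg μ) (h⁻¹ * g) =
      (U : Set G).indicator (fun _ => (f : ConvAlg μ) g) h := by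
    intro h
    by_cases hh : h ∈ U
    · simp [chi_apply, hh, (f.2 h⁻¹ (inv_mem hh) g).1]
    · simp [chi_apply, hh]
  simp only [ConvAlg.mul_apply, this]
  rw [integral_indicator_const _ U.isOpen.measurableSet]
  simp [measureReal_def, hμ]

theorem mul_chi (hμ : μ U = 1) (f : heckeAlg μ U) : (f : ConvAlg μ) * chi μ hU = f := by
  have h := congrArg star (chi_mul μ hU hμ (star f))
  simpa [star_chi] using h

theorem chi_mul_mul_chi (hμ : μ U = 1) (y : L1Hecke μ U) :
    l1HeckeToL1Group μ U y = BanachCompletion.of (ConvAlg μ) (chi μ hU) *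
      l1HeckeToL1Group μ U y * BanachCompletion.of (ConvAlg μ) (chi μ hU) := by
  have hc : Continuous (l1HeckeToL1Group μ U) := BanachCompletion.continuous_map _ _
  refine BanachCompletion.denseRange_of.induction_on
    (p := fun y => l1HeckeToL1Group μ U y = BanachCompletion.of (ConvAlg μ) (chi μ hU) *
      l1HeckeToL1Group μ U y * BanachCompletion.of (ConvAlg μ) (chi μ hU)) y ?_ ?_
  · exact isClosed_eq hc ((continuous_const.mul hc).mul continuous_const)
  · intro f
    have : l1HeckeToL1Group μ U (BanachCompletion.of _ f) =
        BanachCompletion.of (ConvAlg μ) (f : ConvAlg μ) := BanachCompletion.map_of _ _ f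
    rw [this, ← map_mul, ← map_mul, chi_mul μ hU hμ, mul_chi μ hU hμ]

theorem l1Hecke_mem_corner (hμ : μ U = 1) (x : CStarL1Hecke μ U) :
    envelopeMap (l1HeckeToL1Group μ U) (hasEnvelope_of_banach _) (hasEnvelope_of_banach _) x ∈
      cornerGroup μ hU :=
  ⟨_, envelopeMap_eq_of_forall (l1HeckeToL1Group μ U) _ _ (BanachCompletion.of (ConvAlg μ) (chi μ hU))
    (chi_mul_mul_chi μ hU hμ) x⟩

/-- The natural map `C*(G, U) → C*(L¹(G, U))` (when the universal C*-completion `C*(G, U)` of the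
Hecke algebra exists). -/
def heckeCanonicalMap (h : HasEnvelope (heckeAlg μ U)) :
    CStarEnvelope h →⋆ₙₐ[ℂ] CStarL1Hecke μ U :=
  envelopeMap (heckeToL1 μ U) h (hasEnvelope_of_banach (L1Hecke μ U))

/-- The canonical surjection `Π : C*(L¹(G, U)) → p₀ C*(G) p₀`. -/
def canonicalSurjection (hμ : μ U = 1) : CStarL1Hecke μ U →⋆ₙₐ[ℂ] cornerGroup μ hU :=
  NonUnitalStarAlgHom.codRestrict
    (envelopeMap (l1HeckeToL1Group μ U) (hasEnvelope_of_banach _) (hasEnvelope_of_banach _))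
    (cornerGroup μ hU) (l1Hecke_mem_corner μ hU hμ)

end Hecke

end

noncomputable section

universe u


/-! The bridge between the two conditions is that `*`-spherical functions `ω` are the nonzero
`*`-characters of the Hecke algebra, through `f ↦ ∫ f ω`: the functional equation of `ω` is
multiplicativity on indicators of cosets of `U`, and these span the right `U`-invariant functions
(`IsStarSpherical.character`, `exists_isStarSpherical`).

From (a) to (b): the Hecke algebra is commutative, so by Gelfand theory the norm of `f` in any
representation is `|∫ f ω|` for some `*`-spherical `ω`, unless it is zero
(`HilbertRep.exists_character`). A positive definite `ω` satisfies `|ω| ≤ 1`, so every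
representation is contractive for the `L¹`-norm. Hence the universal completion exists, and since
representations extend to `L¹(G,U)`, the first map is isometric. A positive definite `ω` also yields
a GNS representation of `C_c(G)` on the right `U`-invariant functions, in which `∫ f ω` is the
matrix coefficient of `f` at the unit vector `χ_U`. Thus `|∫ f ω|` is at most the norm of `f` in
`C*(G)` (`norm_pairing_le_norm_toEnvelope`), and the second map is isometric. Surjectivity follows
from density, since an isometric image of a complete space is closed.

From (b) to (a): injective `*`-homomorphisms of C*-algebras are isometric, so the character of `ω`
is bounded by the norm of `C*(G)`. Let `v` be right `U`-invariant with image `x` in `C*(G)`, and let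
`p` be the image of `χ_U`. Then `x p = x` gives `‖ ‖x‖² p - x* x ‖ ≤ ‖x‖²`. Applying the character,
`|‖x‖² - ∫ (v* * v) ω| ≤ ‖x‖²`, so `∫ (v* * v) ω ≥ 0`. Expanding `v` in coset indicators, this is
positive definiteness, and boundedness follows from it. -/

/-! ### Extension of representations to completions -/

section Extend

variable {A : Type u} [NonUnitalNormedRing A] [NormedSpace ℂ A] [StarRing A] [NormedStarGroup A]

/-- A contractive `*`-representation extends to the completion, on the same Hilbert space. -/
def HilbertRep.extend (ρ : HilbertRep A) (hρ : ∀ a, ‖ρ.π a‖ ≤ ‖a‖) :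
    HilbertRep (BanachCompletion A) :=
  have huc : UniformContinuous ρ.π :=
    AddMonoidHomClass.uniformContinuous_of_bound ρ.π 1 (by simpa using hρ)
  let e : BanachCompletion A → (ρ.H →L[ℂ] ρ.H) := Completion.extension ρ.π
  have he : Continuous e := Completion.continuous_extension
  have hof (a : A) : e (BanachCompletion.of A a) = ρ.π a := Completion.extension_coe huc a
  { H := ρ.H
    π :=
    { toFun := e
      map_smul' c x := by
        refine BanachCompletion.denseRange_of.induction_on
          (p := fun x => e (c • x) = c • e x) x ?_ ?_
        · exact isClosed_eq (he.comp (continuous_const_smul c)) (he.const_smul c)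
        · intro a
          rw [← map_smul, hof, hof, map_smul]
      map_zero' := by
        rw [← map_zero (BanachCompletion.of A), hof, map_zero]
      map_add' x y := by
        refine BanachCompletion.denseRange_of.induction_on₂
          (p := fun x y => e (x + y) = e x + e y) ?_ ?_ x y
        · exact isClosed_eq (he.comp continuous_add)
            ((he.comp continuous_fst).add (he.comp continuous_snd))
        · intro a b
          rw [← map_add, hof, hof, hof, map_add]
      map_mul' x y := by
        refine BanachCompletion.denseRange_of.induction_on₂
          (p := fun x y => e (x * y) = e x * e y) ?_ ?_ x y
        · exact isClosed_eq (he.comp continuous_mul)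
            ((he.comp continuous_fst).mul (he.comp continuous_snd))
        · intro a b
          rw [← map_mul, hof, hof, hof, map_mul]
      map_star' x := by
        refine BanachCompletion.denseRange_of.induction_on
          (p := fun x => e (star x) = star (e x)) x ?_ ?_
        · exact isClosed_eq (he.comp continuous_star) he.star
        · intro a
          rw [← map_star, hof, hof, map_star] } }

theorem HilbertRep.extend_of (ρ : HilbertRep A) (hρ : ∀ a, ‖ρ.π a‖ ≤ ‖a‖) (a : A) :
    (ρ.extend hρ).π (BanachCompletion.of A a) = ρ.π a :=
  Completion.extension_coe
    (AddMonoidHomClass.uniformContinuous_of_bound ρ.π 1 (by simpa using hρ)) a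

end Extend

/-! ### The norm of the enveloping C*-algebra -/

section EnvelopeNorm

variable {A B : Type u} [NonUnitalRing A] [Module ℂ A] [StarRing A] [NonUnitalRing B] [Module ℂ B]
  [StarRing B]

theorem norm_toEnvelope_le (h : HasEnvelope A) (a : A) {C : ℝ} (hC : 0 ≤ C)
    (hρ : ∀ ρ : HilbertRep A, ‖ρ.π a‖ ≤ C) : ‖toEnvelope h a‖ ≤ C :=
  lp.norm_le_of_forall_le (f := (⟨fun ρ => ρ.π a, memℓp_infty (h a)⟩ :
    lp (fun ρ : HilbertRep A => ρ.H →L[ℂ] ρ.H) ∞)) hC hρ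

theorem HilbertRep.norm_le_norm_toEnvelope (h : HasEnvelope A) (ρ : HilbertRep A) (a : A) :
    ‖ρ.π a‖ ≤ ‖toEnvelope h a‖ :=
  lp.norm_apply_le_norm ENNReal.top_ne_zero (⟨fun ρ => ρ.π a, memℓp_infty (h a)⟩ :
    lp (fun ρ : HilbertRep A => ρ.H →L[ℂ] ρ.H) ∞) ρ

/-- Representations of `B` pull back to representations of `A`, so the supremum for `B` runs over
fewer representations. -/
theorem norm_envelopeMap_le (φ : A →⋆ₙₐ[ℂ] B) (hA : HasEnvelope A) (hB : HasEnvelope B) (a : A) :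
    ‖toEnvelope hB (φ a)‖ ≤ ‖toEnvelope hA a‖ :=
  norm_toEnvelope_le hB _ (norm_nonneg _) fun ρ => (ρ.pullback φ).norm_le_norm_toEnvelope hA a

/-- The reverse norm inequality is needed only on a dense family `i`; this lets both canonical maps
be tested on the Hecke algebra alone. -/
theorem isometry_envelopeMap (φ : A →⋆ₙₐ[ℂ] B) (hA : HasEnvelope A) (hB : HasEnvelope B)
    {ι : Type*} {i : ι → A} (hi : DenseRange fun x => toEnvelope hA (i x))
    (h : ∀ x, ‖toEnvelope hA (i x)‖ ≤ ‖toEnvelope hB (φ (i x))‖) :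
    Isometry (envelopeMap φ hA hB) := by
  refine AddMonoidHomClass.isometry_of_norm _ fun x => ?_
  have hc := continuous_envelopeMap φ hA hB
  refine hi.induction_on (p := fun x => ‖envelopeMap φ hA hB x‖ = ‖x‖) x
    (isClosed_eq hc.norm continuous_norm) fun x => ?_
  rw [envelopeMap_toEnvelope]
  exact (norm_envelopeMap_le φ hA hB _).antisymm (h x)

theorem continuous_toEnvelope {A : Type u} [NonUnitalNormedRing A] [CompleteSpace A]
    [NormedSpace ℂ A] [IsScalarTower ℂ A A] [SMulCommClass ℂ A A] [StarRing A]
    [NormedStarGroup A] (h : HasEnvelope A) : Continuous (toEnvelope h) :=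
  AddMonoidHomClass.continuous_of_bound _ 1 fun a => by
    simpa using norm_toEnvelope_le h a (norm_nonneg a) fun ρ => norm_rep_le ρ a

theorem denseRange_toEnvelope_of {A : Type u} [NonUnitalNormedRing A]
    [NormedSpace ℂ A] [IsScalarTower ℂ A A] [SMulCommClass ℂ A A] [StarRing A]
    [NormedStarGroup A] (h : HasEnvelope (BanachCompletion A)) :
    DenseRange fun a => toEnvelope h (BanachCompletion.of A a) :=
  (denseRange_toEnvelope h).comp BanachCompletion.denseRange_of (continuous_toEnvelope h)

theorem surjective_of_isometry_of_denseRange {X Y : Type*} [MetricSpace X] [CompleteSpace X]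
    [MetricSpace Y] {f : X → Y} (hf : Isometry f) (hd : DenseRange f) : Function.Surjective f := by
  rw [← Set.range_eq_univ, ← hf.isClosedEmbedding.isClosed_range.closure_eq, hd.closure_range]

end EnvelopeNorm

/-! ### Characters from representations of commutative algebras -/

section Characters

variable {A : Type u} [NonUnitalRing A] [Module ℂ A] [StarRing A]

/-- For a `*`-representation of a commutative `*`-algebra, the norm of the image of `a` is attained
at a `*`-character. -/
theorem HilbertRep.exists_character (hcomm : ∀ a b : A, a * b = b * a) (ρ : HilbertRep A) (a : A)
    (ha : ρ.π a ≠ 0) : ∃ χ : A →⋆ₙₐ[ℂ] ℂ, ‖χ a‖ = ‖ρ.π a‖ := by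
  let s : Set (ρ.H →L[ℂ] ρ.H) := Set.range ρ.π
  have hs : ∀ x ∈ s, ∀ y ∈ s, x * y = y * x := by
    rintro _ ⟨x, rfl⟩ _ ⟨y, rfl⟩
    rw [← map_mul, hcomm, map_mul]
  -- The adjoint of an operator in the image is again in the image, so the unital C*-algebra `S`
  -- generated by the image is commutative.
  have hs' : ∀ x ∈ s, ∀ y ∈ s, x * star y = star y * x := by
    rintro _ ⟨x, rfl⟩ _ ⟨y, rfl⟩
    rw [← map_star, ← map_mul, hcomm, map_mul]
  let S : StarSubalgebra ℂ (ρ.H →L[ℂ] ρ.H) := (StarAlgebra.adjoin ℂ s).topologicalClosure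
  have hadj := StarAlgebra.isMulCommutative_adjoin ℂ hs hs'
  let _ : CommCStarAlgebra S :=
    { StarSubalgebra.cstarAlgebra S (h_closed := StarSubalgebra.isClosed_topologicalClosure _) with
      mul_comm := (StarSubalgebra.commRingTopologicalClosure (StarAlgebra.adjoin ℂ s)
        hadj.is_comm.comm).mul_comm }
  have hmem (b : A) : ρ.π b ∈ S :=
    StarSubalgebra.le_topologicalClosure _ (StarAlgebra.subset_adjoin ℂ s ⟨b, rfl⟩)
  let b : S := ⟨ρ.π a, hmem a⟩
  -- Nontriviality makes the character space nonempty. It is compact, so the sup norm of the Gelfand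
  -- transform of `b`, which equals `‖b‖`, is attained.
  have : Nontrivial S := ⟨b, 0, fun h => ha (congrArg Subtype.val h)⟩
  have hb : ‖WeakDual.gelfandTransform ℂ S b‖ = ‖ρ.π a‖ :=
    (gelfandTransform_isometry S).norm_map_of_map_zero (map_zero _) b
  obtain ⟨ψ, hψ⟩ : ∃ ψ : WeakDual.characterSpace ℂ S, ‖ψ b‖ = ‖ρ.π a‖ := by
    by_contra! hne
    have hle (ψ : WeakDual.characterSpace ℂ S) : ‖ψ b‖ ≤ ‖ρ.π a‖ :=
      hb ▸ (WeakDual.gelfandTransform ℂ S b).norm_coe_le_norm ψ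
    exact ((ContinuousMap.norm_lt_iff_of_nonempty _).mpr fun ψ =>
      (hle ψ).lt_of_ne (hne ψ)).ne hb
  exact ⟨{ toFun := fun x => ψ ⟨ρ.π x, hmem x⟩
           map_smul' := fun c x => by
             rw [← map_smul]; exact congrArg ψ (Subtype.ext (map_smul ρ.π c x))
           map_zero' := by
             rw [← map_zero ψ]; exact congrArg ψ (Subtype.ext (map_zero ρ.π))
           map_add' := fun x y => by
             rw [← map_add]; exact congrArg ψ (Subtype.ext (map_add ρ.π x y))
           map_mul' := fun x y => by
             rw [← map_mul]; exact congrArg ψ (Subtype.ext (map_mul ρ.π x y))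
           map_star' := fun x => by
             rw [← map_star]; exact congrArg ψ (Subtype.ext (map_star ρ.π x)) }, hψ⟩

end Characters

/-! ### The Gelfand–Naimark–Segal construction on a left ideal -/

/-- A left ideal `V` of a `*`-algebra together with a hermitian functional that is positive on
`V`. -/
structure LeftIdealState (A : Type u) [NonUnitalRing A] [Module ℂ A] [StarRing A] where
  V : Submodule ℂ A
  φ : A →ₗ[ℂ] ℂ
  mul_mem : ∀ a, ∀ v ∈ V, a * v ∈ V
  map_star : ∀ a, φ (star a) = star (φ a)
  nonneg : ∀ v ∈ V, 0 ≤ φ (star v * v)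

namespace LeftIdealState

variable {A : Type u} [NonUnitalRing A] [Module ℂ A] [StarRing A] [IsScalarTower ℂ A A]
  [SMulCommClass ℂ A A] [StarModule ℂ A] (D : LeftIdealState A)

/-- The left ideal with the semi-inner product `⟪v, w⟫ = φ (star v * w)`. -/
def Pre : Type u := D.V

instance : AddCommGroup D.Pre := inferInstanceAs (AddCommGroup D.V)
instance : Module ℂ D.Pre := inferInstanceAs (Module ℂ D.V)

/-- The inclusion of the left ideal. -/
def incl : D.Pre →ₗ[ℂ] A := D.V.subtype

theorem incl_mem (v : D.Pre) : D.incl v ∈ D.V := Subtype.property (p := (· ∈ D.V)) v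

/-- The semi-inner product. -/
abbrev core : PreInnerProductSpace.Core ℂ D.Pre where
  inner v w := D.φ (star (D.incl v) * D.incl w)
  conj_inner_symm v w := by
    simp [← Complex.star_def, ← D.map_star]
  re_inner_nonneg v := (RCLike.nonneg_iff.mp (D.nonneg _ (D.incl_mem v))).1
  add_left _ _ _ := by rw [map_add, star_add, add_mul, map_add]
  smul_left := by simp [smul_mul_assoc]

instance : SeminormedAddCommGroup D.Pre :=
  InnerProductSpace.Core.toSeminormedAddCommGroup (c := D.core)

instance : InnerProductSpace ℂ D.Pre := InnerProductSpace.ofCore D.core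

theorem inner_def (v w : D.Pre) : inner ℂ v w = D.φ (star (D.incl v) * D.incl w) := rfl

theorem norm_sq (v : D.Pre) : ‖v‖ ^ 2 = (D.φ (star (D.incl v) * D.incl v)).re := by
  rw [← inner_self_eq_norm_sq (𝕜 := ℂ) v, inner_def]; rfl

/-- Left multiplication on the left ideal. -/
def lmul (a : A) : D.Pre →ₗ[ℂ] D.Pre where
  toFun v := (⟨a * D.incl v, D.mul_mem a _ (D.incl_mem v)⟩ : D.V)
  map_add' v w := Subtype.ext <| mul_add a (D.incl v) (D.incl w)
  map_smul' c v := Subtype.ext <| mul_smul_comm c a (D.incl v)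

theorem incl_injective : Function.Injective D.incl := Subtype.val_injective

/-- Left multiplication by every element is bounded on the left ideal. -/
def IsBoundedBy (C : A → ℝ) : Prop := ∀ a, 0 ≤ C a ∧ ∀ v, ‖D.lmul a v‖ ≤ C a * ‖v‖

variable {D} {C : A → ℝ} (hC : D.IsBoundedBy C)

/-- Left multiplication as a bounded operator. -/
def lmulL (a : A) : D.Pre →L[ℂ] D.Pre := (D.lmul a).mkContinuous (C a) (hC a).2

theorem incl_lmulL (a : A) (v : D.Pre) : D.incl (lmulL hC a v) = a * D.incl v := rfl

theorem ext_completion {S T : Completion D.Pre →L[ℂ] Completion D.Pre}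
    (h : ∀ v : D.Pre, S v = T v) : S = T :=
  ContinuousLinearMap.ext fun x => Completion.induction_on x
    (isClosed_eq S.continuous T.continuous) h

theorem completion_lmulL_coe (a : A) (v : D.Pre) :
    (lmulL hC a).completion (v : Completion D.Pre) = ((lmulL hC a v : D.Pre) : Completion D.Pre) :=
  ContinuousLinearMap.completion_apply_coe _ _

theorem completion_lmulL_smul (c : ℂ) (a : A) :
    (lmulL hC (c • a)).completion = c • (lmulL hC a).completion := by
  refine ext_completion fun v => ?_
  rw [completion_lmulL_coe, smul_apply, completion_lmulL_coe,
    ← Completion.coe_smul]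
  exact congrArg _ (D.incl_injective (by rw [map_smul, incl_lmulL, incl_lmulL, smul_mul_assoc]))

theorem completion_lmulL_add (a b : A) :
    (lmulL hC (a + b)).completion = (lmulL hC a).completion + (lmulL hC b).completion := by
  refine ext_completion fun v => ?_
  rw [completion_lmulL_coe, add_apply, completion_lmulL_coe,
    completion_lmulL_coe, ← Completion.coe_add]
  exact congrArg _ (D.incl_injective (by rw [map_add, incl_lmulL, incl_lmulL, incl_lmulL, add_mul]))

theorem completion_lmulL_mul (a b : A) :
    (lmulL hC (a * b)).completion = (lmulL hC a).completion * (lmulL hC b).completion := by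
  refine ext_completion fun v => ?_
  rw [completion_lmulL_coe, mul_apply_eq_comp, completion_lmulL_coe,
    completion_lmulL_coe]
  exact congrArg _ (D.incl_injective (by simp only [incl_lmulL, mul_assoc]))

/-- On the dense subspace both inner products equal `φ (star x * a * y)`. -/
theorem completion_lmulL_star (a : A) :
    (lmulL hC (star a)).completion = star (lmulL hC a).completion := by
  refine (ContinuousLinearMap.eq_adjoint_iff _ _).mpr fun x y => ?_
  induction x, y using Completion.induction_on₂ with
  | hp => exact isClosed_eq (by fun_prop) (by fun_prop)
  | ih x y =>
    rw [completion_lmulL_coe, completion_lmulL_coe, Completion.inner_coe, Completion.inner_coe,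
      inner_def, inner_def, incl_lmulL, incl_lmulL, star_mul, star_star, mul_assoc]

/-- The GNS representation. -/
def gns : HilbertRep A where
  H := Completion D.Pre
  π :=
  { toFun a := (lmulL hC a).completion
    map_smul' := completion_lmulL_smul hC
    -- Homogeneity applied to `0 • 0`.
    map_zero' := by simpa using completion_lmulL_smul hC 0 0
    map_add' := completion_lmulL_add hC
    map_mul' := completion_lmulL_mul hC
    map_star' := completion_lmulL_star hC }

theorem norm_gns_le (a : A) : ‖(gns hC).π a‖ ≤ C a := by
  refine ContinuousLinearMap.opNorm_le_bound _ (hC a).1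
    (show ∀ x : Completion D.Pre, ‖(lmulL hC a).completion x‖ ≤ C a * ‖x‖ from fun x => ?_)
  induction x using Completion.induction_on with
  | hp => exact isClosed_le (by fun_prop) (by fun_prop)
  | ih x =>
    rw [completion_lmulL_coe, Completion.norm_coe, Completion.norm_coe]
    exact (hC a).2 x

/-- `φ (star v * a * v)` is the matrix coefficient of `a` at the vector `v`, so Cauchy–Schwarz
applies. -/
theorem norm_apply_le (a v : A) (hv : v ∈ D.V) :
    ‖D.φ (star v * a * v)‖ ≤ ‖(gns hC).π a‖ * (D.φ (star v * v)).re := by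
  let w : D.Pre := (⟨v, hv⟩ : D.V)
  have h1 : inner ℂ (w : Completion D.Pre) ((lmulL hC a).completion (w : Completion D.Pre)) =
      D.φ (star v * a * v) := by
    rw [completion_lmulL_coe, Completion.inner_coe, inner_def, incl_lmulL, mul_assoc]
    rfl
  have h2 : ‖(w : Completion D.Pre)‖ ^ 2 = (D.φ (star v * v)).re := by
    rw [Completion.norm_coe, norm_sq]
    rfl
  rw [← h1, ← h2]
  calc _ ≤ ‖(w : Completion D.Pre)‖ * ‖(lmulL hC a).completion (w : Completion D.Pre)‖ :=
        norm_inner_le_norm _ _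
    _ ≤ ‖(w : Completion D.Pre)‖ * (‖(lmulL hC a).completion‖ * ‖(w : Completion D.Pre)‖) := by
      gcongr
      exact ContinuousLinearMap.le_opNorm _ _
    _ = ‖(lmulL hC a).completion‖ * ‖(w : Completion D.Pre)‖ ^ 2 := by ring

end LeftIdealState


/-! ### Translations on `C_c(G)` and integration against a continuous function -/

section Translation

variable {G : Type u} [Group G] [TopologicalSpace G] [IsTopologicalGroup G]
  [MeasurableSpace G] [BorelSpace G] {μ : Measure G}

namespace ConvAlg

/-- Left translation `(L_g f)(x) = f(g⁻¹ x)`. -/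
def leftTranslate (g : G) (f : ConvAlg μ) : ConvAlg μ :=
  mk (fun x => f (g⁻¹ * x)) (f.continuous.comp (continuous_const_mul g⁻¹))
    (f.hasCompactSupport.comp_homeomorph (Homeomorph.mulLeft g⁻¹))

theorem leftTranslate_apply (g : G) (f : ConvAlg μ) (x : G) :
    leftTranslate g f x = f (g⁻¹ * x) := rfl

theorem leftTranslate_leftTranslate (g h : G) (f : ConvAlg μ) :
    leftTranslate g (leftTranslate h f) = leftTranslate (g * h) f := by
  ext x
  simp only [leftTranslate_apply, mul_inv_rev, mul_assoc]

/-- The functional `f ↦ ∫ f ω` on `C_c(G)`, for continuous `ω`. -/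
def pairing [IsFiniteMeasureOnCompacts μ] (ω : C(G, ℂ)) : ConvAlg μ →ₗ[ℂ] ℂ where
  toFun f := ∫ x, f x * ω x ∂μ
  map_add' f₁ f₂ := by
    have h (f : ConvAlg μ) : Integrable (fun x => f x * ω x) μ :=
      (f.continuous.mul ω.continuous).integrable_of_hasCompactSupport f.hasCompactSupport.mul_right
    simp only [add_apply, add_mul]
    exact integral_add (h f₁) (h f₂)
  map_smul' c f := by simp [mul_assoc, integral_const_mul]

variable [μ.IsHaarMeasure]

theorem pairing_apply (ω : C(G, ℂ)) (f : ConvAlg μ) : pairing ω f = ∫ x, f x * ω x ∂μ := rfl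

theorem norm_pairing_le (ω : C(G, ℂ)) {C : ℝ} (hω : ∀ g, ‖ω g‖ ≤ C) (f : ConvAlg μ) :
    ‖pairing ω f‖ ≤ C * ‖f‖ := by
  rw [pairing_apply, norm_def, ← integral_const_mul]
  refine norm_integral_le_of_norm_le (f.integrable_norm.const_mul C)
    (Filter.Eventually.of_forall fun x => ?_)
  rw [norm_mul, mul_comm]
  gcongr
  exact hω x

/-- The function `h ↦ ∫ b(x) ω(h x) dμ(x)`. -/
def convRight (b : ConvAlg μ) (ω : C(G, ℂ)) : C(G, ℂ) where
  toFun h := ∫ x, b x * ω (h * x) ∂μ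
  continuous_toFun := by
    rw [← continuousOn_univ]
    refine continuousOn_integral_of_compact_support (k := tsupport b)
      (f := fun h x => b x * ω (h * x)) b.hasCompactSupport ?_ ?_
    · have h1 := b.continuous
      have h2 := ω.continuous
      exact Continuous.continuousOn (by simp only [Function.uncurry_def]; fun_prop)
    · intro g h _ hh
      rw [image_eq_zero_of_notMem_tsupport hh, zero_mul]

theorem convRight_apply (b : ConvAlg μ) (ω : C(G, ℂ)) (h : G) :
    convRight b ω h = ∫ x, b x * ω (h * x) ∂μ := rfl

theorem convRight_eq_pairing (b : ConvAlg μ) (ω : C(G, ℂ)) (h : G) :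
    convRight b ω h = pairing ω (leftTranslate h b) := by
  rw [convRight_apply, pairing_apply,
    ← integral_mul_left_eq_self (fun x => leftTranslate h b x * ω x) h]
  simp [leftTranslate_apply]

theorem convRight_leftTranslate (b : ConvAlg μ) (ω : C(G, ℂ)) (g h : G) :
    convRight (leftTranslate g b) ω h = convRight b ω (h * g) := by
  rw [convRight_eq_pairing, convRight_eq_pairing, leftTranslate_leftTranslate]

theorem hasCompactSupport_prod (a b : ConvAlg μ) :
    HasCompactSupport (fun p : G × G => a p.1 * b p.2) := by
  refine HasCompactSupport.intro' (a.hasCompactSupport.prod b.hasCompactSupport)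
    ((isClosed_tsupport _).prod (isClosed_tsupport _)) ?_
  rintro ⟨g, h⟩ hgh
  by_contra hne
  refine hgh ⟨subset_tsupport _ fun h0 => hne ?_, subset_tsupport _ fun h0 => hne ?_⟩ <;> simp [h0]

/-- Fubini and left invariance: both sides are the double integral of `a(h) b(x) ω(hx)`. -/
theorem pairing_mul (ω : C(G, ℂ)) (a b : ConvAlg μ) :
    pairing ω (a * b) = pairing (convRight b ω) a := by
  have c1 := a.continuous
  have c2 := b.continuous
  have c3 := ω.continuous
  simp only [pairing_apply, mul_apply, convRight_apply, ← integral_mul_const,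
    ← integral_const_mul]
  rw [integral_translate_swap (fun g h => a h * b (h⁻¹ * g) * ω g)]
  · simp [mul_assoc]
  · simp only [Function.uncurry_def]; fun_prop
  · exact (hasCompactSupport_kernel a.hasCompactSupport b.hasCompactSupport).mul_right

/-- Weak form of the fact that `a * b` is the average of the translates of `b` with weight `a`.
Testing against `c` and `ω` avoids a vector-valued integral. -/
theorem pairing_mul_mul (ω : C(G, ℂ)) (c a b : ConvAlg μ) :
    pairing ω (c * (a * b)) = ∫ g, a g * pairing ω (c * leftTranslate g b) ∂μ := by
  have c1 := a.continuous
  have c2 := c.continuous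
  have c3 := (convRight b ω).continuous
  rw [← mul_assoc, pairing_mul, pairing_mul]
  simp only [pairing_mul ω c]
  simp only [pairing_apply, convRight_leftTranslate]
  simp only [convRight_apply (μ := μ) a, ← integral_const_mul]
  rw [integral_integral_swap_of_hasCompactSupport]
  · simp only [mul_left_comm]
  · simp only [Function.uncurry_def]; fun_prop
  · simp only [Function.uncurry_def, ← mul_assoc]
    exact (hasCompactSupport_prod c a).mul_right

section Unimodular

variable [μ.IsMulRightInvariant]

/-- The substitution `h ↦ h g`, allowed by unimodularity. It makes left translations isometric for
the form `⟪v, w⟫ = ∫ (v* * w) ω`. -/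
theorem star_leftTranslate_mul_leftTranslate (g : G) (a b : ConvAlg μ) :
    star (leftTranslate g a) * leftTranslate g b = star a * b := by
  ext x
  rw [mul_apply, mul_apply, ← integral_mul_right_eq_self (fun h => star a h * b (h⁻¹ * x)) g]
  simp [leftTranslate_apply, star_apply, mul_assoc]

theorem integral_inv (f : G → ℂ) (hf : Continuous f) (hs : HasCompactSupport f) :
    ∫ g, f g⁻¹ ∂μ = ∫ g, f g ∂μ := by
  have h1 : Integrable f μ := hf.integrable_of_hasCompactSupport hs
  have h2 : Integrable (fun g => f g⁻¹) μ := (hf.comp continuous_inv).integrable_of_hasCompactSupport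
    (hs.comp_homeomorph (Homeomorph.inv G))
  apply Complex.ext
  · have := integral_inv_of_unimodular (μ := μ) (fun g => (f g).re) (Complex.continuous_re.comp hf)
      (hs.comp_left (g := Complex.re) rfl)
    calc _ = ∫ g, (f g⁻¹).re ∂μ := (integral_re h2).symm
      _ = _ := this.trans (integral_re h1)
  · have := integral_inv_of_unimodular (μ := μ) (fun g => (f g).im) (Complex.continuous_im.comp hf)
      (hs.comp_left (g := Complex.im) rfl)
    calc _ = ∫ g, (f g⁻¹).im ∂μ := (integral_im h2).symm
      _ = _ := this.trans (integral_im h1)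

theorem pairing_star (ω : C(G, ℂ)) (hω : ∀ g, ω g⁻¹ = star (ω g)) (a : ConvAlg μ) :
    pairing ω (star a) = star (pairing ω a) := by
  rw [pairing_apply, pairing_apply, ← integral_inv (fun x => star a x * ω x)
    ((star a).continuous.mul ω.continuous) (star a).hasCompactSupport.mul_right]
  simp only [star_apply, hω, inv_inv, RCLike.star_def, ← integral_conj, map_mul]

end Unimodular

end ConvAlg

end Translation

/-! ### Right `U`-invariant functions -/

section Cosets

variable {G : Type u} [Group G] [TopologicalSpace G] [IsTopologicalGroup G]
  [MeasurableSpace G] [BorelSpace G] {μ : Measure G} [μ.IsHaarMeasure] {U : OpenSubgroup G}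
  [μ.IsMulRightInvariant]

open ConvAlg

variable (μ U) in
/-- The left ideal of right `U`-invariant functions in `C_c(G)`. -/
def rightInvariant : Submodule ℂ (ConvAlg μ) where
  carrier := {f | ∀ u ∈ U, ∀ g, f (g * u) = f g}
  zero_mem' _ _ _ := rfl
  add_mem' h₁ h₂ u hu g := by simp only [ConvAlg.add_apply, h₁ u hu, h₂ u hu]
  smul_mem' c f h u hu g := by simp only [ConvAlg.smul_apply, h u hu]

theorem mul_mem_rightInvariant (a : ConvAlg μ) {b : ConvAlg μ} (hb : b ∈ rightInvariant μ U) :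
    a * b ∈ rightInvariant μ U := by
  intro u hu g
  simp only [mul_apply, ← mul_assoc, hb u hu]

theorem leftTranslate_mem_rightInvariant (g : G) {b : ConvAlg μ} (hb : b ∈ rightInvariant μ U) :
    leftTranslate g b ∈ rightInvariant μ U := by
  intro u hu x
  simp only [leftTranslate_apply, ← mul_assoc, hb u hu]

theorem hecke_mem_rightInvariant (f : heckeAlg μ U) : (f : ConvAlg μ) ∈ rightInvariant μ U :=
  fun u hu g => (f.2 u hu g).2

variable (hU : IsCompact (U : Set G))

theorem chi_congr {g h : G} (hgh : g ∈ U ↔ h ∈ U) : chi μ hU g = chi μ hU h := by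
  by_cases hg : g ∈ (U : Set G)
  · simp only [chi_apply, Set.indicator_of_mem hg, Set.indicator_of_mem (hgh.mp hg)]
  · simp only [chi_apply, Set.indicator_of_notMem hg, Set.indicator_of_notMem (mt hgh.mpr hg)]

theorem chi_mem_rightInvariant : chi μ hU ∈ rightInvariant μ U :=
  fun _ hu _ => chi_congr hU (U.toSubgroup.mul_mem_cancel_right hu)

variable (hμ : μ U = 1)

theorem integral_chi_mul (f : G → ℂ) : ∫ x, chi μ hU x * f x ∂μ = ∫ x in (U : Set G), f x ∂μ := by
  rw [← integral_indicator U.isOpen.measurableSet]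
  congr 1 with x
  by_cases hx : x ∈ (U : Set G) <;> simp [chi_apply, hx]

include hμ in
theorem setIntegral_eq_of_forall {f : G → ℂ} {c : ℂ} (hf : ∀ u ∈ U, f u = c) :
    ∫ x in (U : Set G), f x ∂μ = c := by
  rw [setIntegral_congr_fun U.isOpen.measurableSet (g := fun _ => c) hf]
  simp [measureReal_def, hμ]

theorem chi_inv (g : G) : chi μ hU g⁻¹ = chi μ hU g :=
  chi_congr hU U.toSubgroup.inv_mem_iff

-- The value of `f * χ_U` at `g` is the average of `f` over `gU`, so `χ_U` is a right unit for right
-- `U`-invariant functions.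
include hμ in
theorem mul_chi_of_mem {f : ConvAlg μ} (hf : f ∈ rightInvariant μ U) : f * chi μ hU = f := by
  ext g
  rw [mul_apply, ← integral_mul_left_eq_self _ g]
  calc _ = ∫ h, chi μ hU h * f (g * h) ∂μ := by simp [chi_inv, mul_comm]
    _ = f g := by
      rw [integral_chi_mul]
      exact setIntegral_eq_of_forall hμ fun u hu => hf u hu g

theorem ConvAlg.sum_apply {ι : Type*} (T : Finset ι) (f : ι → ConvAlg μ) (g : G) :
    (∑ i ∈ T, f i) g = ∑ i ∈ T, f i g := by
  classical
  induction T using Finset.induction_on with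
  | empty => rfl
  | insert i T hi ih => rw [Finset.sum_insert hi, Finset.sum_insert hi, add_apply, ih]

/-- A right `U`-invariant compactly supported function is a finite combination of indicator
functions of cosets of `U`. -/
theorem exists_eq_sum_leftTranslate_chi {f : ConvAlg μ} (hf : f ∈ rightInvariant μ U) :
    ∃ (m : ℕ) (s : Fin m → G) (z : Fin m → ℂ),
      f = ∑ k, z k • leftTranslate (s k) (chi μ hU) := by
  -- Since `U` is open, `G ⧸ U` is discrete and the compact support of `f` meets only finitely many
  -- cosets.
  have : DiscreteTopology (G ⧸ U.toSubgroup) := QuotientGroup.discreteTopology U.isOpen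
  have hfin : ((QuotientGroup.mk : G → G ⧸ U.toSubgroup) '' tsupport f).Finite :=
    (f.hasCompactSupport.isCompact.image QuotientGroup.continuous_mk).finite_of_discrete
  let T := hfin.toFinset
  have key : f = ∑ q ∈ T, f q.out • leftTranslate q.out (chi μ hU) := by
    ext x
    -- Cosets are disjoint, so only the one containing `x` contributes.
    rw [ConvAlg.sum_apply, Finset.sum_eq_single (QuotientGroup.mk x)]
    · have hx : (QuotientGroup.mk x : G ⧸ U.toSubgroup).out⁻¹ * x ∈ U :=
        QuotientGroup.eq.mp (Quotient.out_eq' (QuotientGroup.mk x))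
      rw [ConvAlg.smul_apply, leftTranslate_apply, chi_apply, Set.indicator_of_mem hx,
        mul_one, ← hf _ hx (QuotientGroup.mk x : G ⧸ U.toSubgroup).out, mul_inv_cancel_left]
    · intro q _ hq
      rw [ConvAlg.smul_apply, leftTranslate_apply, chi_apply, Set.indicator_of_notMem, mul_zero]
      intro hx
      exact hq ((Quotient.out_eq' q).symm.trans (QuotientGroup.eq.mpr hx))
    · intro hx
      have hx' : (QuotientGroup.mk x : G ⧸ U.toSubgroup).out⁻¹ * x ∈ U :=
        QuotientGroup.eq.mp (Quotient.out_eq' (QuotientGroup.mk x))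
      have : f x = 0 := image_eq_zero_of_notMem_tsupport fun h =>
        hx (hfin.mem_toFinset.mpr ⟨x, h, rfl⟩)
      rw [ConvAlg.smul_apply, ← hf _ hx' (QuotientGroup.mk x : G ⧸ U.toSubgroup).out,
        mul_inv_cancel_left, this, zero_mul]
  refine ⟨T.card, fun k => (T.equivFin.symm k : G ⧸ U.toSubgroup).out,
    fun k => f (T.equivFin.symm k : G ⧸ U.toSubgroup).out, ?_⟩
  rw [Equiv.sum_comp T.equivFin.symm fun q : T =>
    f (q : G ⧸ U.toSubgroup).out • leftTranslate (q : G ⧸ U.toSubgroup).out (chi μ hU)]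
  exact key.trans (Finset.sum_coe_sort T _).symm

end Cosets


/-! ### Spherical functions as characters of the Hecke algebra -/

section Spherical

variable {G : Type u} [Group G] [TopologicalSpace G] [IsTopologicalGroup G]
  [MeasurableSpace G] [BorelSpace G] {μ : Measure G} [μ.IsHaarMeasure] {U : OpenSubgroup G}
  [μ.IsMulRightInvariant] (hU : IsCompact (U : Set G)) (hμ : μ U = 1)

open ConvAlg

theorem leftTranslate_chi_of_mem {u : G} (hu : u ∈ U) :
    leftTranslate u (chi μ hU) = chi μ hU := by
  ext g
  exact chi_congr hU (U.toSubgroup.mul_mem_cancel_left (inv_mem hu))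

/-- Translating both factors by `u` does not change the product, and `χ_U` is self-adjoint and fixed
by translation by `u`. -/
theorem chi_mul_leftTranslate {u : G} (hu : u ∈ U) (f : ConvAlg μ) :
    chi μ hU * leftTranslate u f = chi μ hU * f := by
  have h := star_leftTranslate_mul_leftTranslate u (chi μ hU) f
  rwa [leftTranslate_chi_of_mem hU hu, star_chi] at h

theorem star_leftTranslate_mul (g : G) (a b : ConvAlg μ) :
    star (leftTranslate g a) * b = star a * leftTranslate g⁻¹ b := by
  rw [← star_leftTranslate_mul_leftTranslate g a, leftTranslate_leftTranslate, mul_inv_cancel]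
  congr 1
  ext x
  simp [leftTranslate_apply]

theorem star_leftTranslate_chi_mul_chi (g : G) :
    star (leftTranslate g (chi μ hU)) * chi μ hU = chi μ hU * leftTranslate g⁻¹ (chi μ hU) := by
  rw [star_leftTranslate_mul, star_chi]

include hμ in
theorem chi_mul_chi : chi μ hU * chi μ hU = chi μ hU :=
  mul_chi_of_mem hU hμ (chi_mem_rightInvariant hU)

/-! ### The pairing with biinvariant functions -/

variable {ω : C(G, ℂ)}

include hμ in
theorem convRight_chi (hr : ∀ u ∈ U, ∀ g, ω (g * u) = ω g) : convRight (chi μ hU) ω = ω := by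
  ext g
  rw [convRight_apply, integral_chi_mul hU fun x => ω (g * x)]
  exact setIntegral_eq_of_forall hμ fun u hu => hr u hu g

include hμ in
theorem pairing_leftTranslate_chi (hr : ∀ u ∈ U, ∀ g, ω (g * u) = ω g) (g : G) :
    pairing ω (leftTranslate g (chi μ hU)) = ω g := by
  rw [← convRight_eq_pairing, convRight_chi hU hμ hr]

-- `leftTranslate s (chi μ hU)` is the indicator of `sU`, so the functional equation of spherical
-- functions says that the pairing is multiplicative on coset indicators.
include hμ in
theorem pairing_leftTranslate_chi_mul (hr : ∀ u ∈ U, ∀ g, ω (g * u) = ω g) (s t : G) :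
    pairing ω (leftTranslate s (chi μ hU) * leftTranslate t (chi μ hU)) =
      ∫ u in (U : Set G), ω (s * u * t) ∂μ := by
  rw [pairing_mul, ← convRight_eq_pairing, convRight_apply, integral_chi_mul]
  simp only [convRight_leftTranslate, convRight_chi hU hμ hr]

include hμ in
theorem pairing_star_leftTranslate_chi_mul (hr : ∀ u ∈ U, ∀ g, ω (g * u) = ω g)
    (hl : ∀ u ∈ U, ∀ g, ω (u * g) = ω g) (s t : G) :
    pairing ω (star (leftTranslate s (chi μ hU)) * leftTranslate t (chi μ hU)) =
      ω (s⁻¹ * t) := by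
  rw [star_leftTranslate_mul, star_chi, leftTranslate_leftTranslate, pairing_mul, pairing_apply,
    integral_chi_mul]
  simp only [convRight_leftTranslate, convRight_chi hU hμ hr]
  exact setIntegral_eq_of_forall hμ fun u hu => hl u hu _

-- Identifies the form in the definition of positive definiteness with `v ↦ ∫ (v* * v) ω` on right
-- `U`-invariant functions.
include hμ in
theorem pairing_star_sum_mul_sum (hr : ∀ u ∈ U, ∀ g, ω (g * u) = ω g)
    (hl : ∀ u ∈ U, ∀ g, ω (u * g) = ω g) {m : ℕ} (s : Fin m → G) (z : Fin m → ℂ) :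
    pairing ω (star (∑ k, z k • leftTranslate (s k) (chi μ hU)) *
      ∑ k, z k • leftTranslate (s k) (chi μ hU)) =
      ∑ j, ∑ k, ω ((s j)⁻¹ * s k) * star (z j) * z k := by
  simp only [star_sum, star_smul, Finset.sum_mul_sum, map_sum, smul_mul_smul_comm, map_smul,
    pairing_star_leftTranslate_chi_mul hU hμ hr hl, smul_eq_mul]
  refine Finset.sum_congr rfl fun j _ => Finset.sum_congr rfl fun k _ => by ring

namespace IsSpherical

variable (hω : IsSpherical μ U ω)
include hω

theorem mul_right (u : G) (hu : u ∈ U) (g : G) : ω (g * u) = ω g := by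
  simpa using hω.biinvariant 1 (one_mem U) u hu g

theorem mul_left (u : G) (hu : u ∈ U) (g : G) : ω (u * g) = ω g := by
  simpa using hω.biinvariant u hu 1 (one_mem U) g

-- By bilinearity it suffices to take coset indicators, where this is the functional equation.
include hU hμ in
theorem pairing_mul_of_mem {a b : ConvAlg μ} (ha : a ∈ rightInvariant μ U)
    (hb : b ∈ rightInvariant μ U) : pairing ω (a * b) = pairing ω a * pairing ω b := by
  obtain ⟨m, s, z, rfl⟩ := exists_eq_sum_leftTranslate_chi hU ha
  obtain ⟨n, t, w, rfl⟩ := exists_eq_sum_leftTranslate_chi hU hb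
  simp only [Finset.sum_mul_sum, map_sum, smul_mul_smul_comm, map_smul,
    pairing_leftTranslate_chi_mul hU hμ hω.mul_right, hω.integral_eq, smul_eq_mul,
    pairing_leftTranslate_chi hU hμ hω.mul_right]
  refine Finset.sum_congr rfl fun j _ => Finset.sum_congr rfl fun k _ => by ring

include hμ in
theorem pairing_chi : pairing ω (chi μ hU) = 1 := by
  have h := pairing_leftTranslate_chi hU hμ hω.mul_right 1
  rwa [leftTranslate_chi_of_mem hU (one_mem U), hω.map_one] at h

end IsSpherical

/-- The `*`-character of the Hecke algebra given by a `*`-spherical function. -/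
def IsStarSpherical.character (hω : IsStarSpherical μ U ω) : heckeAlg μ U →⋆ₙₐ[ℂ] ℂ where
  toFun f := pairing ω (f : ConvAlg μ)
  map_smul' c f := map_smul (pairing ω) c (f : ConvAlg μ)
  map_zero' := map_zero (pairing ω)
  map_add' f₁ f₂ := map_add (pairing ω) (f₁ : ConvAlg μ) f₂
  map_mul' f₁ f₂ := hω.pairing_mul_of_mem hU hμ (hecke_mem_rightInvariant f₁)
    (hecke_mem_rightInvariant f₂)
  map_star' f := pairing_star ω hω.map_inv (f : ConvAlg μ)

/-! ### The corner of `C_c(G)` -/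

/-- Right invariance of `star f` is left invariance of `f`. -/
theorem mem_heckeAlg {f : ConvAlg μ} (h₁ : f ∈ rightInvariant μ U)
    (h₂ : star f ∈ rightInvariant μ U) : f ∈ heckeAlg μ U := by
  refine fun u hu g => ⟨?_, h₁ u hu g⟩
  have h := h₂ u⁻¹ (inv_mem hu) g⁻¹
  rw [star_apply, star_apply, mul_inv_rev, inv_inv, inv_inv] at h
  exact star_injective h

variable (μ) in
/-- The map `f ↦ χ_U * f * χ_U` from `C_c(G)` to the Hecke algebra. -/
def heckeProj : ConvAlg μ →ₗ[ℂ] heckeAlg μ U where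
  toFun f := ⟨chi μ hU * f * chi μ hU, mem_heckeAlg
    (mul_mem_rightInvariant _ (chi_mem_rightInvariant hU)) (by
      rw [star_mul, star_mul, star_chi, ← mul_assoc]
      exact mul_mem_rightInvariant _ (chi_mem_rightInvariant hU))⟩
  map_add' f₁ f₂ := Subtype.ext (by simp only [mul_add, add_mul]; rfl)
  map_smul' c f := Subtype.ext (by simp only [mul_smul_comm, smul_mul_assoc]; rfl)

theorem coe_heckeProj (f : ConvAlg μ) :
    (heckeProj μ hU f : ConvAlg μ) = chi μ hU * f * chi μ hU := rfl

include hμ in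
theorem heckeProj_coe (f : heckeAlg μ U) : heckeProj μ hU (f : ConvAlg μ) = f :=
  Subtype.ext (by rw [coe_heckeProj, chi_mul μ hU hμ, mul_chi μ hU hμ])

theorem star_heckeProj (f : ConvAlg μ) : star (heckeProj μ hU f) = heckeProj μ hU (star f) :=
  Subtype.ext (by
    change star (chi μ hU * f * chi μ hU) = chi μ hU * star f * chi μ hU
    rw [star_mul, star_mul, star_chi, mul_assoc])

-- The left factor absorbs the inner copies of `χ_U`, because `a * χ_U = a`.
include hμ in
theorem heckeProj_mul {a b : ConvAlg μ} (ha : a ∈ rightInvariant μ U) :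
    heckeProj μ hU a * heckeProj μ hU b = heckeProj μ hU (a * b) :=
  Subtype.ext (by
    change chi μ hU * a * chi μ hU * (chi μ hU * b * chi μ hU) = chi μ hU * (a * b) * chi μ hU
    rw [mul_assoc _ a, mul_chi_of_mem hU hμ ha, mul_assoc _ b, ← mul_assoc _ (chi μ hU),
      mul_assoc _ a, mul_chi_of_mem hU hμ ha, mul_assoc, mul_assoc, mul_assoc])

theorem continuous_of_mul_right {f : G → ℂ} (hf : ∀ u ∈ U, ∀ g, f (g * u) = f g) :
    Continuous f := by
  refine continuous_iff_continuousAt.mpr fun g => ?_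
  have hmem : {x | g⁻¹ * x ∈ U} ∈ nhds g :=
    (U.isOpen.preimage (continuous_const_mul g⁻¹)).mem_nhds (by simp)
  refine (continuousAt_const (y := f g)).congr ?_
  filter_upwards [hmem] with x hx
  rw [← hf _ hx g, mul_inv_cancel_left]

include hU hμ in
/-- Every nonzero `*`-character of the Hecke algebra is given by a `*`-spherical function. -/
theorem exists_isStarSpherical (χ : heckeAlg μ U →⋆ₙₐ[ℂ] ℂ) (f₀ : heckeAlg μ U) (hf₀ : χ f₀ ≠ 0) :
    ∃ ω : C(G, ℂ), IsStarSpherical μ U ω ∧ ∀ f : heckeAlg μ U, χ f = pairing ω (f : ConvAlg μ) := by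
  -- The argument of `χ` is the indicator of `UgU` divided by its measure; pairing a biinvariant
  -- function with it returns the value at `g`, which forces this definition.
  let w : G → ℂ := fun g => χ (heckeProj μ hU (leftTranslate g (chi μ hU)))
  have hr : ∀ u ∈ U, ∀ g, w (g * u) = w g := fun u hu g => by
    simp only [w, ← leftTranslate_leftTranslate, leftTranslate_chi_of_mem hU hu]
  have hl : ∀ u ∈ U, ∀ g, w (u * g) = w g := fun u hu g => by
    refine congrArg χ (Subtype.ext ?_)
    rw [coe_heckeProj, coe_heckeProj, ← leftTranslate_leftTranslate, chi_mul_leftTranslate hU hu]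
  let ω : C(G, ℂ) := ⟨w, continuous_of_mul_right hr⟩
  -- Both sides are linear in `f` and agree on coset indicators.
  have key : ∀ f ∈ rightInvariant μ U, χ (heckeProj μ hU f) = pairing ω f := by
    intro f hf
    obtain ⟨m, s, z, rfl⟩ := exists_eq_sum_leftTranslate_chi hU hf
    simp only [map_sum, map_smul, pairing_leftTranslate_chi hU hμ (ω := ω) hr]
    rfl
  have hpair (f : heckeAlg μ U) : χ f = pairing ω (f : ConvAlg μ) := by
    rw [← key _ (hecke_mem_rightInvariant f), heckeProj_coe hU hμ]
  refine ⟨ω, ⟨⟨ω.continuous, ?_, fun u₁ h₁ u₂ h₂ g => ?_, fun g₁ g₂ => ?_⟩, fun g => ?_⟩, hpair⟩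
  -- `χ_U` is the unit of the Hecke algebra, so its image is `1` once the character is nonzero.
  · refine mul_right_cancel₀ hf₀ ?_
    change χ (heckeProj μ hU (leftTranslate 1 (chi μ hU))) * χ f₀ = 1 * χ f₀
    rw [leftTranslate_chi_of_mem hU (one_mem U), ← map_mul, one_mul]
    refine congrArg χ (Subtype.ext ?_)
    change chi μ hU * chi μ hU * chi μ hU * (f₀ : ConvAlg μ) = f₀
    rw [chi_mul_chi hU hμ, chi_mul_chi hU hμ, chi_mul μ hU hμ]
  · exact (hr u₂ h₂ _).trans (hl u₁ h₁ g)
  · rw [← pairing_leftTranslate_chi_mul hU hμ (ω := ω) hr, ← key, ← heckeProj_mul hU hμ, map_mul]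
    · rfl
    · exact leftTranslate_mem_rightInvariant _ (chi_mem_rightInvariant hU)
    · exact mul_mem_rightInvariant _
        (leftTranslate_mem_rightInvariant _ (chi_mem_rightInvariant hU))
  · change χ (heckeProj μ hU (leftTranslate g⁻¹ (chi μ hU))) =
      star (χ (heckeProj μ hU (leftTranslate g (chi μ hU))))
    rw [← map_star, star_heckeProj]
    refine congrArg χ (Subtype.ext ?_)
    rw [coe_heckeProj, coe_heckeProj, mul_assoc _ (star _), star_leftTranslate_chi_mul_chi,
      ← mul_assoc, chi_mul_chi hU hμ, mul_assoc,
      mul_chi_of_mem hU hμ (leftTranslate_mem_rightInvariant _ (chi_mem_rightInvariant hU))]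

/-! ### The representation of `C_c(G)` defined by a positive definite function -/

theorem IsPositiveDefinite.norm_le {ω : G → ℂ} (h : IsPositiveDefinite ω) (h1 : ω 1 = 1)
    (hinv : ∀ g, ω g⁻¹ = star (ω g)) (g : G) : ‖ω g‖ ≤ 1 := by
  rcases eq_or_ne (ω g) 0 with h0 | h0
  · simp [h0]
  have hn : (‖ω g‖ : ℂ) ≠ 0 := by exact_mod_cast norm_ne_zero_iff.mpr h0
  have hs : ω g * star (ω g) = (‖ω g‖ : ℂ) ^ 2 := Complex.mul_conj' _
  have hpos := h 2 ![1, g] ![-1, star (ω g) / ‖ω g‖]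
  -- The second coefficient carries the opposite phase of `ω g`, so each cross term is `-‖ω g‖` and
  -- the whole form is `2 - 2‖ω g‖`.
  simp only [Fin.sum_univ_two, Matrix.cons_val_zero, Matrix.cons_val_one, inv_one, one_mul, mul_one,
    inv_mul_cancel, h1, hinv, star_neg, star_one, star_div₀, star_star] at hpos
  have hr : star (‖ω g‖ : ℂ) = ‖ω g‖ := Complex.conj_ofReal _
  rw [hr] at hpos
  have : (-1 * -1 + ω g * -1 * (star (ω g) / ↑‖ω g‖) + (star (ω g) * (ω g / ↑‖ω g‖) * -1 +
      ω g / ↑‖ω g‖ * (star (ω g) / ↑‖ω g‖)) : ℂ) = ((2 - 2 * ‖ω g‖ : ℝ) : ℂ) := by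
    push_cast
    field_simp
    linear_combination (1 - 2 * (‖ω g‖ : ℂ)) * hs
  rw [this, Complex.zero_le_real] at hpos
  linarith

namespace IsStarSpherical

variable (hω : IsStarSpherical μ U ω) (hpd : IsPositiveDefinite ω)

/-- The left ideal of right `U`-invariant functions with the functional defined by a positive
definite `*`-spherical function. -/
def leftIdealState : LeftIdealState (ConvAlg μ) where
  V := rightInvariant μ U
  φ := pairing ω
  mul_mem a _ hv := mul_mem_rightInvariant a hv
  map_star := pairing_star ω hω.map_inv
  -- Elements of this ideal are finite combinations of coset indicators, so positivity is the
  -- definition of positive definiteness with no approximation of integrals.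
  nonneg v hv := by
    obtain ⟨m, s, z, rfl⟩ := exists_eq_sum_leftTranslate_chi hU hv
    rw [pairing_star_sum_mul_sum hU hμ hω.mul_right hω.mul_left]
    exact hpd m s z

/-- `a * v` is an average of translates of `v`, all of the same norm. Hence `‖a * v‖² = ∫ a(g) ⟪a *
v, L_g v⟫ dμ(g) ≤ ‖a‖ ‖a * v‖ ‖v‖`, and one factor `‖a * v‖` cancels. -/
theorem isBoundedBy_norm : (hω.leftIdealState hU hμ hpd).IsBoundedBy fun a => ‖a‖ := by
  set D := hω.leftIdealState hU hμ hpd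
  refine fun a => ⟨norm_nonneg a, fun v => ?_⟩
  let T (g : G) : D.Pre := (⟨leftTranslate g (D.incl v),
    leftTranslate_mem_rightInvariant g (D.incl_mem v)⟩ : D.V)
  have hT (g : G) : ‖T g‖ = ‖v‖ := by
    rw [← sq_eq_sq₀ (norm_nonneg _) (norm_nonneg _), D.norm_sq, D.norm_sq]
    exact congrArg (fun x => (D.φ x).re) (star_leftTranslate_mul_leftTranslate g _ _)
  have h1 : inner ℂ (D.lmul a v) (D.lmul a v) = ∫ g, a g * inner ℂ (D.lmul a v) (T g) ∂μ :=
    pairing_mul_mul ω (star (a * D.incl v)) a (D.incl v)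
  have h0 : ‖inner ℂ (D.lmul a v) (D.lmul a v)‖ = ‖D.lmul a v‖ ^ 2 := by
    rw [inner_self_eq_norm_sq_to_K, norm_pow, RCLike.norm_ofReal, abs_norm]
  have h2 : ‖D.lmul a v‖ ^ 2 ≤ ‖a‖ * (‖D.lmul a v‖ * ‖v‖) := by
    rw [← h0, h1, norm_def, ← integral_mul_const]
    refine norm_integral_le_of_norm_le (a.integrable_norm.mul_const _)
      (Filter.Eventually.of_forall fun g => ?_)
    rw [norm_mul, ← hT g]
    gcongr
    exact norm_inner_le_norm _ _
  rcases (norm_nonneg (D.lmul a v)).eq_or_lt' with h | h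
  · rw [h]; positivity
  · nlinarith

-- `χ_U` is a unit vector of the GNS representation with matrix coefficient `∫ f ω`; the
-- representation is `L¹`-contractive, so it extends to `L¹(G)`.
include hU hμ hω hpd in
theorem norm_pairing_le_norm_toEnvelope (f : heckeAlg μ U) :
    ‖pairing ω (f : ConvAlg μ)‖ ≤ ‖toEnvelope (hasEnvelope_of_banach (L1Group μ))
      (BanachCompletion.of (ConvAlg μ) (f : ConvAlg μ))‖ := by
  have hC := hω.isBoundedBy_norm hU hμ hpd
  have h1 := LeftIdealState.norm_apply_le hC (f : ConvAlg μ) (chi μ hU) (chi_mem_rightInvariant hU)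
  have h2 := ((LeftIdealState.gns hC).extend (LeftIdealState.norm_gns_le hC)).norm_le_norm_toEnvelope
    (hasEnvelope_of_banach (L1Group μ)) (BanachCompletion.of (ConvAlg μ) (f : ConvAlg μ))
  rw [HilbertRep.extend_of] at h2
  change ‖pairing ω (star (chi μ hU) * (f : ConvAlg μ) * chi μ hU)‖ ≤
    _ * (pairing ω (star (chi μ hU) * chi μ hU)).re at h1
  rw [star_chi, chi_mul μ hU hμ, mul_chi μ hU hμ, chi_mul_chi hU hμ, hω.pairing_chi hU hμ,
    Complex.one_re, mul_one] at h1
  exact h1.trans h2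

end IsStarSpherical

end Spherical


/-! ### One-dimensional representations and a norm estimate -/

section Characters

/-- The one-dimensional representation given by a `*`-character. -/
def HilbertRep.ofCharacter {A : Type u} [NonUnitalRing A] [Module ℂ A] [StarRing A]
    (χ : A →⋆ₙₐ[ℂ] ℂ) : HilbertRep A where
  -- A copy of `ℂ` in the universe required by `HilbertRep`.
  H := EuclideanSpace ℂ PUnit.{u + 1}
  π := (StarAlgHom.ofId ℂ
    (EuclideanSpace ℂ PUnit.{u + 1} →L[ℂ] EuclideanSpace ℂ PUnit.{u + 1})).toNonUnitalStarAlgHom.comp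
      χ

theorem HilbertRep.norm_ofCharacter {A : Type u} [NonUnitalRing A] [Module ℂ A] [StarRing A]
    (χ : A →⋆ₙₐ[ℂ] ℂ) (a : A) : ‖(HilbertRep.ofCharacter χ).π a‖ = ‖χ a‖ :=
  norm_algebraMap' (EuclideanSpace ℂ PUnit.{u + 1} →L[ℂ] EuclideanSpace ℂ PUnit.{u + 1}) (χ a)

/-- The projection `p` plays the part of the unit: `x* x = p x* x p ≤ ‖x‖² p`, so the difference
lies between `0` and `‖x‖² p`. -/
theorem norm_smul_sub_star_mul_self_le {B : Type*} [NonUnitalCStarAlgebra B] {p x : B}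
    (hp : IsSelfAdjoint p) (hpp : p * p = p) (hx : x * p = x) :
    ‖(‖x‖ ^ 2 : ℝ) • p - star x * x‖ ≤ ‖x‖ ^ 2 := by
  let _ : PartialOrder B := CStarAlgebra.spectralOrder B
  have : StarOrderedRing B := CStarAlgebra.spectralOrderedRing B
  have hx' : p * star x = star x := by simpa [hp.star_eq] using congrArg star hx
  have hp1 : ‖p‖ ≤ 1 := by
    have h := CStarRing.norm_star_mul_self (x := p)
    rw [hp.star_eq, hpp] at h
    nlinarith [norm_nonneg p]
  have hle : star x * x ≤ (‖x‖ ^ 2 : ℝ) • p := by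
    have h := CStarAlgebra.star_left_conjugate_le_norm_smul (a := p) (b := star x * x)
      (IsSelfAdjoint.star_mul_self x)
    rwa [hp.star_eq, hpp, ← mul_assoc, hx', mul_assoc, hx, CStarRing.norm_star_mul_self,
      ← sq] at h
  have h1 : ‖(‖x‖ ^ 2 : ℝ) • p - star x * x‖ ≤ ‖(‖x‖ ^ 2 : ℝ) • p‖ :=
    CStarAlgebra.norm_le_norm_of_nonneg_of_le (sub_nonneg.mpr hle)
      (sub_le_self _ (star_mul_self_nonneg x))
  refine h1.trans ?_
  rw [norm_smul, Real.norm_of_nonneg (by positivity)]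
  exact mul_le_of_le_one_right (by positivity) hp1

end Characters

/-! ### Comparison of the enveloping C*-algebras -/

section Comparison

variable {G : Type u} [Group G] [TopologicalSpace G] [IsTopologicalGroup G]
  [MeasurableSpace G] [BorelSpace G] {μ : Measure G} [μ.IsHaarMeasure] {U : OpenSubgroup G}
  [μ.IsMulRightInvariant] (hU : IsCompact (U : Set G)) (hμ : μ U = 1)

open ConvAlg

theorem IsGelfandPair.heckeAlg_comm (h : IsGelfandPair μ U) (a b : heckeAlg μ U) :
    a * b = b * a := by
  rw [← sub_eq_zero, ← norm_eq_zero, ← BanachCompletion.norm_of, map_sub, map_mul, map_mul,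
    h, sub_self, norm_zero]

theorem l1HeckeToL1Group_of (f : heckeAlg μ U) :
    l1HeckeToL1Group μ U (BanachCompletion.of _ f) =
      BanachCompletion.of (ConvAlg μ) (f : ConvAlg μ) :=
  BanachCompletion.map_of _ _ f

/-- For `f` in `C_c(G)` the compression is the image of `χ_U * f * χ_U`, which lies in the Hecke
algebra; density and the closed range give the rest of the corner. -/
theorem p₀_mul_mul_p₀_mem_range (h : IsClosed (Set.range (envelopeMap (l1HeckeToL1Group μ U)
      (hasEnvelope_of_banach (L1Hecke μ U)) (hasEnvelope_of_banach (L1Group μ)))))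
    (x : CStarGroup μ) :
    p₀ μ hU * x * p₀ μ hU ∈ Set.range (envelopeMap (l1HeckeToL1Group μ U)
      (hasEnvelope_of_banach (L1Hecke μ U)) (hasEnvelope_of_banach (L1Group μ))) := by
  have hc : Continuous fun x : CStarGroup μ => p₀ μ hU * x * p₀ μ hU :=
    (continuous_const.mul continuous_id).mul continuous_const
  have hf (f : ConvAlg μ) : p₀ μ hU * toEnvelope (hasEnvelope_of_banach (L1Group μ))
      (BanachCompletion.of (ConvAlg μ) f) * p₀ μ hU ∈
      Set.range (envelopeMap (l1HeckeToL1Group μ U)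
        (hasEnvelope_of_banach (L1Hecke μ U)) (hasEnvelope_of_banach (L1Group μ))) := by
    refine ⟨toEnvelope _ (heckeToL1 μ U (heckeProj μ hU f)), ?_⟩
    rw [envelopeMap_toEnvelope, l1HeckeToL1Group_of, coe_heckeProj, map_mul, map_mul, map_mul,
      map_mul]
    rfl
  exact (denseRange_toEnvelope_of (hasEnvelope_of_banach (L1Group μ))).induction_on x
    (h.preimage hc) hf

/-- If the natural maps are injective, the norms of an element of the Hecke algebra in `C*(G, U)`
and in `C*(G)` agree. -/
theorem norm_toEnvelope_eq_of_injective (h : HasEnvelope (heckeAlg μ U))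
    (h₁ : Function.Injective (heckeCanonicalMap μ h))
    (h₂ : Function.Injective (canonicalSurjection μ hU hμ)) (f : heckeAlg μ U) :
    ‖toEnvelope h f‖ = ‖toEnvelope (hasEnvelope_of_banach (L1Group μ))
      (BanachCompletion.of (ConvAlg μ) (f : ConvAlg μ))‖ := by
  have h₃ : Function.Injective (envelopeMap (l1HeckeToL1Group μ U)
      (hasEnvelope_of_banach (L1Hecke μ U)) (hasEnvelope_of_banach (L1Group μ))) :=
    fun x y hxy => h₂ (Subtype.ext hxy)
  rw [← NonUnitalStarAlgHom.norm_map _ h₁, ← NonUnitalStarAlgHom.norm_map _ h₃,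
    ← l1HeckeToL1Group_of]
  rfl

include hU hμ in
theorem IsStarSpherical.isPositiveDefinite {ω : C(G, ℂ)} (hω : IsStarSpherical μ U ω)
    (h : ∀ f : heckeAlg μ U, ‖pairing ω (f : ConvAlg μ)‖ ≤
      ‖toEnvelope (hasEnvelope_of_banach (L1Group μ))
        (BanachCompletion.of (ConvAlg μ) (f : ConvAlg μ))‖) :
    IsPositiveDefinite ω := by
  intro m s z
  rw [← pairing_star_sum_mul_sum hU hμ hω.mul_right hω.mul_left]
  set v : ConvAlg μ := ∑ k, z k • leftTranslate (s k) (chi μ hU)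
  have hv : v ∈ rightInvariant μ U := Submodule.sum_mem _ fun k _ =>
    Submodule.smul_mem _ _ (leftTranslate_mem_rightInvariant _ (chi_mem_rightInvariant hU))
  set j : ConvAlg μ →⋆ₙₐ[ℂ] CStarGroup μ :=
    (toEnvelope (hasEnvelope_of_banach (L1Group μ))).comp (BanachCompletion.of (ConvAlg μ))
  -- `v` need not be left invariant, but `star v * v` and `χ_U` are biinvariant, so the bound `h`
  -- applies to their combinations.
  let a : heckeAlg μ U := ⟨star v * v, mem_heckeAlg (mul_mem_rightInvariant _ hv)
    (by rw [star_mul, star_star]; exact mul_mem_rightInvariant _ hv)⟩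
  let e : heckeAlg μ U := ⟨chi μ hU, mem_heckeAlg (chi_mem_rightInvariant hU)
    (by rw [star_chi]; exact chi_mem_rightInvariant hU)⟩
  have h1 := norm_smul_sub_star_mul_self_le (p := j (chi μ hU)) (x := j v)
    (isSelfAdjoint_p₀ μ hU) (by rw [← map_mul, chi_mul_chi hU hμ])
    (by rw [← map_mul, mul_chi_of_mem hU hμ hv])
  have h2 : ‖pairing ω (((‖j v‖ ^ 2 : ℝ) : ℂ) • chi μ hU - star v * v)‖ ≤
      ‖j (((‖j v‖ ^ 2 : ℝ) : ℂ) • chi μ hU - star v * v)‖ :=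
    h (((‖j v‖ ^ 2 : ℝ) : ℂ) • e - a)
  rw [map_sub, map_sub j, map_smul, map_smul j, hω.pairing_chi hU hμ, map_mul j, map_star j,
    smul_eq_mul, mul_one, Complex.coe_smul] at h2
  have h3 : star (pairing ω (star v * v)) = pairing ω (star v * v) := by
    rw [← pairing_star ω hω.map_inv, star_mul, star_star]
  obtain ⟨r, hr⟩ := Complex.conj_eq_iff_real.mp h3
  rw [hr] at h2 ⊢
  rw [← Complex.ofReal_sub, Complex.norm_real] at h2
  -- With `r` the real value of the pairing at `star v * v`, `|‖x‖² - r| ≤ ‖x‖²` forces `r ≥ 0`.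
  have h4 := (abs_le.mp (h2.trans h1)).2
  exact Complex.zero_le_real.mpr (by linarith)

end Comparison

end

/-! ### The equivalence -/

theorem mainTheorem8 {G : Type*} [Group G] [TopologicalSpace G] [IsTopologicalGroup G]
    [LocallyCompactSpace G] [T2Space G] [MeasurableSpace G] [BorelSpace G]
    (μ : Measure G) [μ.IsHaarMeasure] [μ.IsMulRightInvariant]
    (U : OpenSubgroup G) (hU : IsCompact (U : Set G)) (hμ : μ U = 1)
    (hGelfand : IsGelfandPair μ U) :
    (∀ ω : G → ℂ, IsStarSpherical μ U ω →
      (∃ C : ℝ, ∀ g, ‖ω g‖ ≤ C) ∧ IsPositiveDefinite ω) ↔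
    ∃ h : HasEnvelope (heckeAlg μ U),
      Function.Bijective (heckeCanonicalMap μ h) ∧
      Function.Bijective (canonicalSurjection μ hU hμ) := by
  constructor
  · intro hpd
    have hchar (ρ : HilbertRep (heckeAlg μ U)) (f : heckeAlg μ U) (hf : ρ.π f ≠ 0) :
        ∃ ω : C(G, ℂ), IsStarSpherical μ U ω ∧
          ‖ρ.π f‖ = ‖ConvAlg.pairing ω (f : ConvAlg μ)‖ := by
      obtain ⟨χ, hχ⟩ := ρ.exists_character hGelfand.heckeAlg_comm f hf
      obtain ⟨ω, hω, hωχ⟩ := exists_isStarSpherical hU hμ χ f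
        (norm_ne_zero_iff.mp (hχ ▸ norm_ne_zero_iff.mpr hf))
      exact ⟨ω, hω, by rw [← hχ, hωχ]⟩
    have hL1 (ρ : HilbertRep (heckeAlg μ U)) (f : heckeAlg μ U) : ‖ρ.π f‖ ≤ ‖f‖ := by
      by_cases hf : ρ.π f = 0
      · rw [hf, norm_zero]; exact norm_nonneg f
      obtain ⟨ω, hω, h⟩ := hchar ρ f hf
      rw [h]
      simpa using ConvAlg.norm_pairing_le ω
        ((hpd ω hω).2.norm_le hω.map_one hω.map_inv) (f : ConvAlg μ)
    have hE : HasEnvelope (heckeAlg μ U) := fun f => ⟨‖f‖, by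
      rintro _ ⟨ρ, rfl⟩
      exact hL1 ρ f⟩
    -- Every representation of the Hecke algebra is `L¹`-contractive, hence extends to `L¹(G,U)`:
    -- both algebras give the same supremum.
    have iso₁ : Isometry (heckeCanonicalMap μ hE) :=
      isometry_envelopeMap _ _ _ (i := id) (denseRange_toEnvelope hE) fun f =>
        norm_toEnvelope_le hE _ (norm_nonneg _) fun ρ => by
          have := (ρ.extend (hL1 ρ)).norm_le_norm_toEnvelope
            (hasEnvelope_of_banach (L1Hecke μ U)) (heckeToL1 μ U f)
          rwa [HilbertRep.extend_of] at this
    -- The norm of `f` in a representation of `L¹(G,U)` is `|∫ f ω|` for some `ω`, which the GNS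
    -- representation of `ω` bounds by the norm in `C*(G)`.
    have iso₂ : Isometry (envelopeMap (l1HeckeToL1Group μ U)
        (hasEnvelope_of_banach (L1Hecke μ U)) (hasEnvelope_of_banach (L1Group μ))) :=
      isometry_envelopeMap _ _ _ (denseRange_toEnvelope_of _) fun f =>
        norm_toEnvelope_le _ _ (norm_nonneg _) fun ρ => by
          by_cases hf : ρ.π (heckeToL1 μ U f) = 0
          · rw [hf, norm_zero]; exact norm_nonneg _
          obtain ⟨ω, hω, h⟩ := hchar (ρ.pullback (heckeToL1 μ U)) f hf
          rw [l1HeckeToL1Group_of]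
          exact h.le.trans (hω.norm_pairing_le_norm_toEnvelope hU hμ (hpd ω hω).2 f)
    refine ⟨hE, ⟨iso₁.injective, surjective_of_isometry_of_denseRange iso₁ ?_⟩,
      fun x y hxy => iso₂.injective (congrArg Subtype.val hxy), ?_⟩
    · refine (denseRange_toEnvelope_of (hasEnvelope_of_banach (L1Hecke μ U))).mono ?_
      rintro _ ⟨f, rfl⟩
      exact ⟨toEnvelope hE f, rfl⟩
    · rintro ⟨_, x, rfl⟩
      suffices p₀ μ hU * x * p₀ μ hU ∈ Set.range (envelopeMap (l1HeckeToL1Group μ U)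
          (hasEnvelope_of_banach (L1Hecke μ U)) (hasEnvelope_of_banach (L1Group μ))) by
        obtain ⟨y, hy⟩ := this
        exact ⟨y, Subtype.ext hy⟩
      exact p₀_mul_mul_p₀_mem_range hU iso₂.isClosedEmbedding.isClosed_range x
  · rintro ⟨hE, ⟨h₁, -⟩, h₂, -⟩ ω hω
    let ω' : C(G, ℂ) := ⟨ω, hω.continuous⟩
    have hω' : IsStarSpherical μ U ω' := hω
    have hpd : IsPositiveDefinite ω := hω'.isPositiveDefinite hU hμ fun f => by
      rw [← norm_toEnvelope_eq_of_injective hU hμ hE h₁ h₂]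
      -- The character of `ω` is a one-dimensional representation, so it is bounded by the universal
      -- norm.
      have := (HilbertRep.ofCharacter (hω'.character hU hμ)).norm_le_norm_toEnvelope hE f
      rwa [HilbertRep.norm_ofCharacter] at this
    exact ⟨⟨1, hpd.norm_le hω.map_one hω.map_inv⟩, hpd⟩
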